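/- A \emph{convex polyhedron} in $\mathbb{R}^n$ is an intersection of finitely many closed half-spaces (not necessarily bounded). A set $X\subset\mathbb{R}^k$ is \emph{semialgebraic} if it is a finite boolean combination of sets defined by polynomial equalities and inequalities. A map $f:X\to\mathbb{R}^n$ with $X\subset\mathbb{R}$ semialgebraic is \emph{Nash} if it extends to a $C^\infty$ map with semialgebraic graph on some open semialgebraic neighbourhood of $X$. A \emph{Nash bridge} between two open semialgebraic sets $T_1,T_2\subset\mathbb{R}^n$ is the image $\Gamma$ of a Nash map $\gamma:[-1,1]\to\mathbb{R}^n$ with $\gamma([-1,0))\subset T_1$ and $\gamma((0,1])\subset T_2$; the point $\gamma(0)$ is its \emph{base point}. For a continuous semialgebraic path $\beta:[a,b]\to\mathbb{R}^n$, $\eta(\beta)$ denotes the smallest finite subset of $[a,b]$ such that $\beta$ is Nash on $[a,b]\setminus\eta(\beta)$. \textbf{Theorem (PL case).} Let $r\ge 1$, let $S_1,\ldots,S_r\subset\mathbb{R}^n$ be the interiors of $n$-dimensional convex polyhedra (not necessarily pairwise different) and put $S:=\bigcup_{i=1}^rS_i$. Pick control points $p_i\in\operatorname{Cl}(S_i)$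 for $i=1,\ldots,r$, and suppose that for $i=1,\ldots,r-1$ there is a Nash bridge $\Gamma_i$ between $S_i$ and $S_{i+1}$, with base point $q_i$ (so that $q_i\in\operatorname{Cl}(S_i)\cap\operatorname{Cl}(S_{i+1})$). Fix control times $0<t_1<\cdots<t_r<1$ and $s_i\in(t_i,t_{i+1})$ for $i=1,\ldots,r-1$. Let $\beta:[t_1,t_r]\to\mathbb{R}^n$ be the piecewise linear parameterization of the polygonal path through $p_1,q_1,p_2,\ldots,p_{r-1},q_{r-1},p_r$ that passes through these points at the times $t_1<s_1<t_2<\cdots<t_{r-1}<s_{r-1}<t_r$ and is affine between consecutive times. Then $\beta$ takes values in $\operatorname{Cl}(S)$ and $\eta(\beta)\subset\{t_2,\ldots,t_{r-1},s_1,\ldots,s_{r-1}\}$, and for every $\varepsilon>0$ there is a polynomial map $\alpha:\mathbb{R}\to\mathbb{R}^n$ such that: (i) $\alpha([0,1])\subset S\cup\{p_1,\ldots,p_r,q_1,\ldots,q_{r-1}\}$; (ii) $\alpha(t_i)=p_i$ for $i=1,\ldots,r$; (iii) $\alpha((t_i,s_i))\subset S_i$, $\alpha((s_i,t_{i+1}))\subset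 S_{i+1}$ and $\alpha(s_i)=q_i$ for $i=1,\ldots,r-1$; (iv) $\|\alpha(x)-\beta(x)\|<\varepsilon$ for every $x\in[t_1,t_r]$. -/

import Mathlib

open Set Polynomial
open scoped ContDiff

/-- Semialgebraic subsets of `ℝ^ι`: the finite boolean combinations of polynomial equalities and
inequalities. -/
inductive IsSemialgebraic {ι : Type} : Set (ι → ℝ) → Prop
  | pos (f : MvPolynomial ι ℝ) : IsSemialgebraic {x | 0 < MvPolynomial.eval x f}
  | zero (f : MvPolynomial ι ℝ) : IsSemialgebraic {x | MvPolynomial.eval x f = 0}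
  | compl {A : Set (ι → ℝ)} : IsSemialgebraic A → IsSemialgebraic Aᶜ
  | inter {A B : Set (ι → ℝ)} : IsSemialgebraic A → IsSemialgebraic B → IsSemialgebraic (A ∩ B)

/-- A subset of the real line is semialgebraic (the line being `ℝ^ι` for a one-point `ι`). -/
def IsSemialgebraicLine (U : Set ℝ) : Prop :=
  IsSemialgebraic {z : Unit → ℝ | z () ∈ U}

/-- The map `F : U → ℝⁿ`, `U ⊆ ℝ`, is semialgebraic: its graph is a semialgebraic subset of
`ℝ × ℝⁿ`. The coordinate `none` is the variable of the source, the coordinates `some i` are those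
of the target. -/
def IsSemialgebraicMapOn {n : ℕ} (F : ℝ → EuclideanSpace ℝ (Fin n)) (U : Set ℝ) : Prop :=
  IsSemialgebraic {z : Option (Fin n) → ℝ | z none ∈ U ∧ ∀ i, z (some i) = F (z none) i}

/-- The map `f : X → ℝⁿ`, `X ⊆ ℝ`, is Nash: it has an extension to an open semialgebraic
neighbourhood of `X` that is smooth and semialgebraic. -/
def IsNashOn {n : ℕ} (f : ℝ → EuclideanSpace ℝ (Fin n)) (X : Set ℝ) : Prop :=
  ∃ (U : Set ℝ) (F : ℝ → EuclideanSpace ℝ (Fin n)),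
    IsOpen U ∧ IsSemialgebraicLine U ∧ X ⊆ U ∧
    ContDiffOn ℝ ∞ F U ∧ IsSemialgebraicMapOn F U ∧ EqOn F f X

/-- `Γ` is a Nash bridge between `S` and `T` with base point `q`. -/
def IsNashBridge {n : ℕ} (S T Γ : Set (EuclideanSpace ℝ (Fin n)))
    (q : EuclideanSpace ℝ (Fin n)) : Prop :=
  ∃ γ : ℝ → EuclideanSpace ℝ (Fin n),
    IsNashOn γ (Icc (-1) 1) ∧ γ '' Ico (-1) 0 ⊆ S ∧ γ '' Ioc 0 1 ⊆ T ∧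
    γ '' Icc (-1) 1 = Γ ∧ γ 0 = q

/-- A convex polyhedron: the intersection of finitely many closed half-spaces. It need not be
bounded. -/
def IsConvexPolyhedron {n : ℕ} (K : Set (EuclideanSpace ℝ (Fin n))) : Prop :=
  ∃ (k : ℕ) (h : Fin k → EuclideanSpace ℝ (Fin n) →ᵃ[ℝ] ℝ), K = {x | ∀ j, 0 ≤ h j x}

/-- `S` is the interior of a convex polyhedron of full dimension, that is, of one whose affine
hull is the whole space. -/
def IsPolyhedronInterior {n : ℕ} (S : Set (EuclideanSpace ℝ (Fin n))) : Prop :=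
  ∃ K : Set (EuclideanSpace ℝ (Fin n)),
    IsConvexPolyhedron K ∧ affineSpan ℝ K = ⊤ ∧ S = interior K

/-- The smallest finite subset `η` of `[a, b]` such that `f` is Nash on `[a, b] \ η`. -/
def nashSingularSet {n : ℕ} (f : ℝ → EuclideanSpace ℝ (Fin n)) (a b : ℝ) : Set ℝ :=
  ⋂₀ {η : Set ℝ | η.Finite ∧ η ⊆ Icc a b ∧ IsNashOn f (Icc a b \ η)}

/-- On `[t₀, t_m]` the map `β` is the piecewise linear parameterization of the polygonal path with
the successive vertices `p₀, q₀, p₁, …, p_{m-1}, q_{m-1}, p_m`, which passes through them at the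
times `t₀ < s₀ < t₁ < ⋯ < t_{m-1} < s_{m-1} < t_m` and is affine in between. -/
structure IsPolygonalParam {n m : ℕ} (t : Fin (m + 1) → ℝ) (s : Fin m → ℝ)
    (p : Fin (m + 1) → EuclideanSpace ℝ (Fin n)) (q : Fin m → EuclideanSpace ℝ (Fin n))
    (β : ℝ → EuclideanSpace ℝ (Fin n)) : Prop where
  at_t : ∀ i, β (t i) = p i
  at_s : ∀ i, β (s i) = q i
  affine_left : ∀ i : Fin m, ∀ u ∈ Icc (0 : ℝ) 1,
    β (AffineMap.lineMap (t i.castSucc) (s i) u) = AffineMap.lineMap (p i.castSucc) (q i) u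
  affine_right : ∀ i : Fin m, ∀ u ∈ Icc (0 : ℝ) 1,
    β (AffineMap.lineMap (s i) (t i.succ) u) = AffineMap.lineMap (q i) (p i.succ) u

/-- The polynomial map `ℝ → ℝⁿ` with components `A₁, …, A_n`. -/
def polyPath {n : ℕ} (A : Fin n → ℝ[X]) (x : ℝ) : EuclideanSpace ℝ (Fin n) :=
  WithLp.toLp 2 (fun i => (A i).eval x)

open scoped Topology

/-! The proof combines approximation with contact and a Łojasiewicz inequality. The nodes are all
the times `t i` and `s i`. At each node one needs a polynomial path through the prescribed point
whose distance to the complement of the current polyhedron is at least a power of the distance to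
the node. Given such local paths, convexity and a partition of unity glue them into a continuous
path close to `β`, inside the open sets off the nodes and equal to the local polynomials near the
nodes. Weierstrass approximation combined with Hermite interpolation
(`exists_polynomial_sub_le_prod_pow`) then gives a global polynomial path whose error is a small
multiple of the product of the `(x - τ i) ^ N`. By compactness such an error stays below the margin
on all of `[0, 1]`; this is `exists_polyPath_of_local`.

At a control point a parabola-like path `p + (x - a)² (c - p)` works (`exists_polyPath_touching`).
At a base point one takes a Taylor polynomial of the bridge. It stays on the correct sides because
each defining affine function, evaluated along the bridge, is at least a power of `|x|`
(`IsSemialgebraicMapOn.exists_pow_le`).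

The Łojasiewicz inequality is proved in an ultrapower `L` of the reals. If it failed, along some
ultrafilter the germ `y` of a positive polynomial expression in the curve would lie below every
power of `|x|`, hence be transcendental over `ℝ(x)`. Choose `K ⊇ ℝ(x)` with `y` transcendental over
`K` and `L` algebraic over `K(y)`. Then `y` can be moved slightly, keeping `x` and the finitely many
sign conditions that define the graph (`exists_same_signs_of_transcendental`). This contradicts the
fact that the graph determines `y` from `x`. -/

/-- The value at `z` of a rational function. -/
noncomputable def ratFuncValue {K L : Type*} [Field K] [Field L] [Algebra K L]
    (u : RatFunc K) (z : L) : L :=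
  aeval z u.num / aeval z u.denom

/-! ### Moving a transcendental coordinate under finitely many sign conditions -/

section Perturbation

open scoped IntermediateField Topology

variable {K L : Type*} [Field K] [Field L] [Algebra K L]

/-- Some transcendental element lies arbitrarily close to a given transcendental element. -/
lemma exists_transcendental_near [LinearOrder L] [IsStrictOrderedRing L] {y : L}
    (hy : Transcendental K y) {ε : L} (hε : 0 < ε) :
    ∃ z, Transcendental K z ∧ z ≠ y ∧ |z - y| < ε := by
  by_cases h2 : Transcendental K (y + ε / 2)
  · refine ⟨_, h2, by simp [hε.ne'], ?_⟩
    rw [add_sub_cancel_left, abs_of_pos (by positivity)]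
    linarith
  · refine ⟨y + ε / 3, fun h3 => ?_, by simp [hε.ne'], ?_⟩
    · apply hy
      have h2' : IsAlgebraic K (y + ε / 2) := not_not.1 h2
      -- This combination cancels `ε`, so at least one of the two shifts of `y` is transcendental,
      -- whatever `ε` is.
      have h : y = (3 : ℕ) • (y + ε / 3) - (2 : ℕ) • (y + ε / 2) := by
        simp only [nsmul_eq_mul]; push_cast; ring
      rw [h]
      exact (h3.nsmul 3).sub (h2'.nsmul 2)
    · rw [add_sub_cancel_left, abs_of_pos (by positivity)]
      linarith

/-- A polynomial changes sign at a simple root. -/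
lemma Polynomial.eventually_mul_neg_of_simple_root [LinearOrder L] [IsStrictOrderedRing L]
    [TopologicalSpace L] [OrderTopology L] (p : L[X]) {a : L} (h0 : p.eval a = 0)
    (h1 : p.derivative.eval a ≠ 0) :
    ∀ᶠ η in 𝓝[>] (0 : L), p.eval (a - η) * p.eval (a + η) < 0 := by
  obtain ⟨r, rfl⟩ := dvd_iff_isRoot.2 h0
  have hr : r.eval a ≠ 0 := by simpa using h1
  have hc : Filter.Tendsto (fun η : L => r.eval (a - η) * r.eval (a + η)) (𝓝 0)
      (𝓝 (r.eval a * r.eval a)) := by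
    have : Continuous (fun η : L => r.eval (a - η) * r.eval (a + η)) := by
      have := r.continuous
      fun_prop
    simpa using this.tendsto 0
  have hpos : 0 < r.eval a * r.eval a := mul_self_pos.2 hr
  filter_upwards [nhdsWithin_le_nhds (hc.eventually (lt_mem_nhds hpos)), self_mem_nhdsWithin]
    with η h hη
  have hη : 0 < η := hη
  have : eval (a - η) ((X - C a) * r) * eval (a + η) ((X - C a) * r)
      = -(η ^ 2 * (r.eval (a - η) * r.eval (a + η))) := by
    simp; ring
  rw [this]
  have : 0 < η ^ 2 * (r.eval (a - η) * r.eval (a + η)) := by positivity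
  linarith

/-- The denominator cannot vanish at a transcendental point. Values are defined at every `z`,
algebraic ones included, so that continuity in the order topology of `L` makes sense. -/
lemma continuousAt_ratFuncValue [TopologicalSpace L] [IsTopologicalDivisionRing L] (u : RatFunc K)
    {y : L} (hy : Transcendental K y) : ContinuousAt (ratFuncValue (L := L) u) y := by
  unfold ratFuncValue
  refine ContinuousAt.div (Polynomial.continuous_aeval _).continuousAt
    (Polynomial.continuous_aeval _).continuousAt fun h => ?_
  exact u.denom_ne_zero ((transcendental_iff.1 hy) _ h)

/-- The embedding of `K(y)` that sends `y` to another transcendental element `z`. -/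
noncomputable def transcendentalEmbedding {y z : L} (hy : Transcendental K y)
    (hz : Transcendental K z) : K⟮y⟯ →ₐ[K] L :=
  (K⟮z⟯.val.comp (RatFunc.algEquivOfTranscendental z hz).toAlgHom).comp
    (RatFunc.algEquivOfTranscendental y hy).symm.toAlgHom

lemma transcendentalEmbedding_apply {y z : L} (hy : Transcendental K y)
    (hz : Transcendental K z) (c : K⟮y⟯) :
    transcendentalEmbedding hy hz c
      = ratFuncValue ((RatFunc.algEquivOfTranscendental y hy).symm c) z := by
  have := RatFunc.algEquivOfTranscendental_apply z hz ((RatFunc.algEquivOfTranscendental y hy).symm c)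
  simpa [transcendentalEmbedding, ratFuncValue] using this

lemma transcendentalEmbedding_gen {y z : L} (hy : Transcendental K y) (hz : Transcendental K z) :
    transcendentalEmbedding hy hz (IntermediateField.AdjoinSimple.gen K y) = z := by
  simp [transcendentalEmbedding]

lemma ratFuncValue_self {y : L} (hy : Transcendental K y) (c : K⟮y⟯) :
    ratFuncValue ((RatFunc.algEquivOfTranscendental y hy).symm c) y = c := by
  rw [ratFuncValue, ← RatFunc.algEquivOfTranscendental_apply y hy, AlgEquiv.apply_symm_apply]

/-- The value at `(z, w)` of a polynomial over `K(y)`, where `z` is substituted for `y`. -/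
noncomputable def adjoinPolyValue {y : L} (hy : Transcendental K y) (p : K⟮y⟯[X]) (v : L × L) : L :=
  ∑ k ∈ Finset.range (p.natDegree + 1),
    ratFuncValue ((RatFunc.algEquivOfTranscendental y hy).symm (p.coeff k)) v.1 * v.2 ^ k

lemma adjoinPolyValue_self {y : L} (hy : Transcendental K y) (p : K⟮y⟯[X]) (w : L) :
    adjoinPolyValue hy p (y, w) = aeval w p := by
  simp only [adjoinPolyValue, ratFuncValue_self, aeval_eq_sum_range]
  rfl

/-- This links analysis and algebra: the function used for continuity is, at transcendental `z`,
evaluation through a field embedding. -/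
lemma adjoinPolyValue_eq {y z : L} (hy : Transcendental K y) (hz : Transcendental K z)
    (p : K⟮y⟯[X]) (w : L) : adjoinPolyValue hy p (z, w)
      = p.eval₂ (transcendentalEmbedding hy hz : K⟮y⟯ →+* L) w := by
  rw [eval₂_eq_sum_range]
  simp only [adjoinPolyValue, RingHom.coe_coe, transcendentalEmbedding_apply]

lemma continuousAt_adjoinPolyValue [TopologicalSpace L] [IsTopologicalDivisionRing L] {y : L}
    (hy : Transcendental K y) (p : K⟮y⟯[X]) (w : L) :
    ContinuousAt (adjoinPolyValue hy p) (y, w) := by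
  unfold adjoinPolyValue
  refine tendsto_finsetSum (M := L) _ fun k _ => ?_
  refine ContinuousAt.mul ?_ (continuousAt_snd.pow k)
  exact ContinuousAt.comp (f := Prod.fst) (x := (y, w)) (continuousAt_ratFuncValue _ hy)
    continuousAt_fst

/-- If `L` is an ordered field with the intermediate value property for polynomials which is
algebraic over `K(y)`, `y` transcendental over `K`, then a finite system of sign conditions over `K`
that is satisfied by a tuple of elements of `L` is also satisfied by a tuple at which `y` takes a
different value. -/
theorem exists_same_signs_of_transcendental [LinearOrder L] [IsStrictOrderedRing L] [CharZero K]
    (ivt : ∀ (p : L[X]) (a b : L), a < b → p.eval a * p.eval b < 0 → ∃ c ∈ Ioo a b, p.eval c = 0)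
    {y : L} (hy : Transcendental K y) [Algebra.IsAlgebraic K⟮y⟯ L] {κ : Type*} [Finite κ]
    (Y : κ → L) (G : Finset (MvPolynomial κ K)) :
    ∃ Y' : κ → L,
      (∀ g ∈ G, SignType.sign (MvPolynomial.aeval Y' g) = SignType.sign (MvPolynomial.aeval Y g)) ∧
      ∀ H : MvPolynomial κ K, MvPolynomial.aeval Y H = y → MvPolynomial.aeval Y' H ≠ y := by
  let _ : TopologicalSpace L := Preorder.topology L
  have : OrderTopology L := ⟨rfl⟩
  set E := IntermediateField.adjoin K⟮y⟯ (range Y) with hE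
  have : FiniteDimensional K⟮y⟯ E :=
    IntermediateField.finiteDimensional_adjoin fun x _ => (Algebra.IsAlgebraic.isAlgebraic x).isIntegral
  let pb := Field.powerBasisOfFiniteOfSeparable K⟮y⟯ E
  -- All coordinates are polynomials over `K(y)` in this primitive element, so moving the tuple
  -- reduces to moving the pair `(y, θ)`.
  let θ : L := pb.gen
  have hθint : IsIntegral K⟮y⟯ θ := (Algebra.IsAlgebraic.isAlgebraic θ).isIntegral
  have hrep : ∀ j, ∃ a : K⟮y⟯[X], aeval θ a = Y j := fun j => by
    obtain ⟨a, ha⟩ := pb.exists_eq_aeval' ⟨Y j, IntermediateField.subset_adjoin _ _ ⟨j, rfl⟩⟩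
    refine ⟨a, ?_⟩
    have := congrArg (algebraMap E L) ha
    rw [← aeval_algebraMap_apply] at this
    exact this.symm
  choose a ha using hrep
  let Q : MvPolynomial κ K → K⟮y⟯[X] := fun g => MvPolynomial.aeval a g
  have hQ : ∀ g, aeval θ (Q g) = MvPolynomial.aeval Y g := fun g => by
    have : ((aeval θ : K⟮y⟯[X] →ₐ[K⟮y⟯] L).restrictScalars K).comp (MvPolynomial.aeval a)
        = MvPolynomial.aeval Y := by
      ext j; simp [ha]
    exact DFunLike.congr_fun this g
  let m := minpoly K⟮y⟯ θ
  have hm0 : (m.map (algebraMap K⟮y⟯ L)).eval θ = 0 := by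
    rw [eval_map_algebraMap]; exact minpoly.aeval _ _
  have hm1 : (m.map (algebraMap K⟮y⟯ L)).derivative.eval θ ≠ 0 := by
    rw [derivative_map, eval_map_algebraMap]
    exact (minpoly.irreducible hθint).separable.aeval_derivative_ne_zero (minpoly.aeval _ _)
  -- Continuity protects only the nonzero signs. Vanishing is preserved algebraically, by `hτ0`.
  have hsign : ∀ᶠ v : L × L in 𝓝 y ×ˢ 𝓝 θ, ∀ g ∈ G, MvPolynomial.aeval Y g ≠ 0 →
      SignType.sign (adjoinPolyValue hy (Q g) v) = SignType.sign (MvPolynomial.aeval Y g) := by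
    rw [← nhds_prod_eq]
    refine (Filter.eventually_all_finset G).2 fun g _ => ?_
    by_cases h0 : MvPolynomial.aeval Y g = 0
    · exact Filter.Eventually.of_forall fun v h => absurd h0 h
    have hc := continuousAt_adjoinPolyValue hy (Q g) θ
    have hv : adjoinPolyValue hy (Q g) (y, θ) = MvPolynomial.aeval Y g := by
      rw [adjoinPolyValue_self, hQ]
    rw [ContinuousAt, hv] at hc
    rcases lt_or_gt_of_ne h0 with h | h
    · filter_upwards [hc.eventually (gt_mem_nhds h)] with v hv _
      rw [sign_neg hv, sign_neg h]
    · filter_upwards [hc.eventually (lt_mem_nhds h)] with v hv _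
      rw [sign_pos hv, sign_pos h]
  obtain ⟨pa, hpa, pc, hpc, hpp⟩ := Filter.eventually_prod_iff.1 hsign
  obtain ⟨δ, hδ, hδc⟩ := (nhds_basis_abs_sub_lt θ).eventually_iff.1 hpc
  have hη : ∀ᶠ η in 𝓝[>] (0 : L), η < δ := nhdsWithin_le_nhds (gt_mem_nhds hδ)
  obtain ⟨η, ⟨hη1, hηδ⟩, hη0⟩ :=
    (((Polynomial.eventually_mul_neg_of_simple_root _ hm0 hm1).and hη).and
      self_mem_nhdsWithin).exists
  have hη0 : 0 < η := hη0
  -- The minimal polynomial changes sign between `θ - η` and `θ + η`. With the bracket fixed, this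
  -- persists when `y` is replaced by a nearby `z`, and the intermediate value property then yields
  -- a root `w` near `θ`.
  have hcont : ContinuousAt (fun z : L => adjoinPolyValue hy m (z, θ - η)
      * adjoinPolyValue hy m (z, θ + η)) y :=
    (ContinuousAt.comp (f := fun z : L => (z, θ - η)) (continuousAt_adjoinPolyValue hy m _)
      (by fun_prop)).mul
    (ContinuousAt.comp (f := fun z : L => (z, θ + η)) (continuousAt_adjoinPolyValue hy m _)
      (by fun_prop))
  have hneg : ∀ᶠ z in 𝓝 y, adjoinPolyValue hy m (z, θ - η) * adjoinPolyValue hy m (z, θ + η) < 0 := by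
    refine hcont.eventually (gt_mem_nhds ?_)
    simp only [adjoinPolyValue_self]
    simpa only [eval_map_algebraMap] using hη1
  obtain ⟨ε, hε, hεz⟩ := (nhds_basis_abs_sub_lt y).eventually_iff.1 (hpa.and hneg)
  obtain ⟨z, hz, hzy, hzε⟩ := exists_transcendental_near hy hε
  obtain ⟨hpaz, hnegz⟩ := hεz hzε
  let σ : K⟮y⟯ →ₐ[K] L := transcendentalEmbedding hy hz
  rw [adjoinPolyValue_eq hy hz, adjoinPolyValue_eq hy hz, ← eval_map, ← eval_map] at hnegz
  obtain ⟨w, hw, hw0⟩ := ivt _ _ _ (by linarith) hnegz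
  have hwδ : |w - θ| < δ := by
    rw [abs_lt]; constructor <;> linarith [hw.1, hw.2]
  let τ : K⟮y⟯[X] →+* L := eval₂RingHom (σ : K⟮y⟯ →+* L) w
  -- Every relation satisfied by `θ` is a multiple of its minimal polynomial, whose transported
  -- version vanishes at `w`.
  have hτ0 : ∀ p : K⟮y⟯[X], aeval θ p = 0 → τ p = 0 := fun p hp => by
    obtain ⟨r, rfl⟩ := minpoly.dvd K⟮y⟯ θ hp
    rw [map_mul]
    have : τ (minpoly K⟮y⟯ θ) = 0 := by
      rw [eval_map] at hw0; exact hw0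
    rw [this, zero_mul]
  have hτQ : ∀ g, MvPolynomial.aeval (fun j => τ (a j)) g = τ (Q g) := fun g => by
    simp only [Q, MvPolynomial.aeval_def]
    rw [MvPolynomial.hom_eval₂]
    congr 1
    ext c
    simp [τ, IsScalarTower.algebraMap_apply K K⟮y⟯ K⟮y⟯[X]]
  refine ⟨fun j => τ (a j), fun g hg => ?_, fun H hH h => hzy ?_⟩
  · rw [hτQ]
    by_cases h0 : MvPolynomial.aeval Y g = 0
    · rw [h0, hτ0 _ (by rw [hQ, h0])]
    · rw [← hpp hpaz (hδc hwδ) g hg h0, adjoinPolyValue_eq hy hz]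
      rfl
  · have h1 : τ (Q H - C (IntermediateField.AdjoinSimple.gen K y)) = 0 := by
      apply hτ0
      rw [map_sub, hQ, hH, aeval_C, IntermediateField.AdjoinSimple.algebraMap_gen, sub_self]
    rw [map_sub, sub_eq_zero, ← hτQ, h] at h1
    rw [h1]
    simpa [τ, σ] using (transcendentalEmbedding_gen hy hz).symm

end Perturbation

/-! ### Transcendence bases and clearing denominators -/

section FieldTheory

open scoped IntermediateField IntermediateField.algebraAdjoinAdjoin

/-- An element that is transcendental over `k` is transcendental over a subfield over which it
generates a field with algebraic extension `L`. -/
lemma exists_intermediateField_transcendental {k L : Type*} [Field k] [Field L] [Algebra k L]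
    {y : L} (hy : Transcendental k y) :
    ∃ K : IntermediateField k L, Transcendental K y ∧ Algebra.IsAlgebraic K⟮y⟯ L := by
  have hi : AlgebraicIndepOn k id {y} :=
    (algebraicIndependent_singleton_iff (x := fun i : ({y} : Set L) => id (i : L))
      ⟨y, rfl⟩).2 hy
  obtain ⟨s, hs, hb⟩ := exists_isTranscendenceBasis_superset hi
  have hys : y ∈ s := hs rfl
  -- Extend `{y}` to a transcendence basis and let the remaining basis elements generate the field.
  refine ⟨IntermediateField.adjoin k (s \ {y}), fun h => ?_, ⟨fun z => ?_⟩⟩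
  · have h1 := hb.1.transcendental_adjoin (s := {i : s | (i : L) ≠ y}) (i := ⟨y, hys⟩)
      (by simp)
    have himg : ((↑) : s → L) '' {i : s | (i : L) ≠ y} = s \ {y} := by
      ext z; simp [and_comm]
    rw [himg] at h1
    exact h1 ((IsFractionRing.isAlgebraic_iff (Algebra.adjoin k (s \ {y}))
      (IntermediateField.adjoin k (s \ {y})) L).2 h)
  · have h1 := hb.isAlgebraic_field.isAlgebraic z
    rw [Subtype.range_coe] at h1
    set K := IntermediateField.adjoin k (s \ {y})
    have hle : IntermediateField.adjoin k s ≤ (K⟮y⟯).restrictScalars k := by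
      rw [IntermediateField.adjoin_le_iff]
      intro w hw
      by_cases hwy : w = y
      · subst hwy
        exact IntermediateField.mem_adjoin_simple_self K w
      · exact (K⟮y⟯).algebraMap_mem
          (⟨w, IntermediateField.subset_adjoin k _ ⟨hw, hwy⟩⟩ : K)
    obtain ⟨p, hp, hpz⟩ := h1
    let φ : IntermediateField.adjoin k s →+* K⟮y⟯ :=
      (IntermediateField.adjoin k s).val.toRingHom.codRestrict K⟮y⟯ fun c => hle c.2
    refine ⟨p.map φ, (Polynomial.map_ne_zero_iff φ.injective).2 hp, ?_⟩
    · rw [aeval_def, eval₂_map]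
      exact hpz

/-- An element that is algebraic over `k(x)` satisfies a polynomial equation over `k[x]`. -/
lemma exists_bivariate_of_isAlgebraic_adjoin_simple {k L : Type*} [Field k] [Field L] [Algebra k L]
    {x y : L} (h : IsAlgebraic k⟮x⟯ y) :
    ∃ q : k[X][X], q ≠ 0 ∧ q.eval₂ (aeval x : k[X] →ₐ[k] L).toRingHom y = 0 := by
  obtain ⟨p, hp, hpy⟩ := (IsFractionRing.isAlgebraic_iff (Algebra.adjoin k {x}) k⟮x⟯ L).2 h
  have hx : ∀ r : k[X], aeval x r ∈ Algebra.adjoin k {x} := fun r =>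
    aeval_mem_adjoin_singleton k x
  let φ : k[X] →+* Algebra.adjoin k {x} := (aeval x : k[X] →ₐ[k] L).toRingHom.codRestrict _ hx
  have hφ : Function.Surjective φ := fun r => by
    obtain ⟨r', hr'⟩ := (Algebra.adjoin_singleton_eq_range_aeval k x).le r.2
    exact ⟨r', Subtype.ext hr'⟩
  obtain ⟨q, rfl⟩ := Polynomial.map_surjective φ hφ p
  refine ⟨q, fun h0 => hp (by rw [h0, Polynomial.map_zero]), ?_⟩
  rw [aeval_def, eval₂_map] at hpy
  exact hpy

end FieldTheory

/-! ### Ultrapowers of the reals and flat germs -/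

section Germ

open Filter

variable {α : Type*}

/-- Germs of real functions form an algebra over the reals. -/
noncomputable instance Filter.Germ.instAlgebraReal (l : Filter α) : Algebra ℝ (Germ l ℝ) :=
  Algebra.ofModule
    (fun r f g => by
      induction f using Germ.inductionOn
      induction g using Germ.inductionOn
      norm_cast
      rw [smul_mul_assoc])
    (fun r f g => by
      induction f using Germ.inductionOn
      induction g using Germ.inductionOn
      norm_cast
      rw [mul_smul_comm])

lemma Filter.Germ.algebraMap_real (l : Filter α) (r : ℝ) :
    algebraMap ℝ (Germ l ℝ) r = ((fun _ => r : α → ℝ) : Germ l ℝ) := by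
  rw [Algebra.algebraMap_eq_smul_one, ← Germ.coe_one, ← Germ.coe_smul]
  congr 1
  ext
  simp

lemma Filter.Germ.aeval_coe (l : Filter α) {κ : Type*} (Y : κ → α → ℝ) (g : MvPolynomial κ ℝ) :
    MvPolynomial.aeval (fun j => (Y j : Germ l ℝ)) g
      = ((fun x => MvPolynomial.eval (fun j => Y j x) g : α → ℝ) : Germ l ℝ) := by
  induction g using MvPolynomial.induction_on with
  | C a => simp [Filter.Germ.algebraMap_real]
  | add p q hp hq => rw [map_add, hp, hq, ← Germ.coe_add]; congr 1; ext; simp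
  | mul_X p i hp => rw [map_mul, hp, MvPolynomial.aeval_X, ← Germ.coe_mul]; congr 1; ext; simp

/-- Lifting the coefficients to functions makes evaluation pointwise, so that the real intermediate
value theorem can be applied at each parameter. -/
lemma Filter.Germ.eval_coe (l : Filter α) (p : (α → ℝ)[X]) (a : α → ℝ) :
    (p.map (Germ.coeRingHom l)).eval (a : Germ l ℝ)
      = ((fun x => (p.map (Pi.evalRingHom _ x)).eval (a x) : α → ℝ) : Germ l ℝ) := by
  rw [show (a : Germ l ℝ) = Germ.coeRingHom l a from rfl, eval_map, eval₂_hom]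
  change ((eval a p : α → ℝ) : Germ l ℝ) = _
  congr 1
  ext x
  rw [show a x = Pi.evalRingHom (fun _ => ℝ) x a from rfl, eval_map, eval₂_hom]
  rfl

/-- Polynomials over an ultrapower of the reals have the intermediate value property. -/
lemma Filter.Germ.exists_isRoot_of_mul_neg (𝒰 : Ultrafilter α) (p : (Germ (𝒰 : Filter α) ℝ)[X])
    (a b : Germ (𝒰 : Filter α) ℝ) (hab : a < b) (h : p.eval a * p.eval b < 0) :
    ∃ c ∈ Ioo a b, p.eval c = 0 := by
  induction a using Germ.inductionOn with | _ a
  induction b using Germ.inductionOn with | _ b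
  obtain ⟨p, rfl⟩ := Polynomial.map_surjective (Germ.coeRingHom (𝒰 : Filter α))
    (fun f => Germ.inductionOn f fun f => ⟨f, rfl⟩) p
  simp only [Germ.eval_coe] at h ⊢
  rw [← Germ.coe_mul, ← Germ.coe_zero, Germ.coe_lt] at h
  rw [Germ.coe_lt] at hab
  have key : ∀ᶠ x in (𝒰 : Filter α), ∃ c ∈ Ioo (a x) (b x),
      (p.map (Pi.evalRingHom _ x)).eval c = 0 := by
    filter_upwards [h, hab] with x hx hab
    set P := p.map (Pi.evalRingHom _ x)
    have hx : P.eval (a x) * P.eval (b x) < 0 := hx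
    rcases mul_neg_iff.1 hx with ⟨h1, h2⟩ | ⟨h1, h2⟩
    · exact intermediate_value_Ioo' hab.le P.continuousOn ⟨h2, h1⟩
    · exact intermediate_value_Ioo hab.le P.continuousOn ⟨h1, h2⟩
  obtain ⟨c, hc⟩ := key.choice
  refine ⟨(c : Germ (𝒰 : Filter α) ℝ), ⟨?_, ?_⟩, ?_⟩
  · exact Germ.coe_lt.2 (hc.mono fun x hx => hx.1.1)
  · exact Germ.coe_lt.2 (hc.mono fun x hx => hx.1.2)
  · rw [Germ.eval_coe]
    exact Germ.coe_eq.2 (hc.mono fun x hx => hx.2)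

/-- Trichotomy for germs along an ultrafilter shows that each representing function has, almost
everywhere, the sign of its germ. -/
lemma Filter.Germ.sign_coe_eq_iff (𝒰 : Ultrafilter α) (f g : α → ℝ) :
    SignType.sign (f : Germ (𝒰 : Filter α) ℝ) = SignType.sign (g : Germ (𝒰 : Filter α) ℝ) ↔
      ∀ᶠ x in (𝒰 : Filter α), SignType.sign (f x) = SignType.sign (g x) := by
  have key : ∀ f : α → ℝ, ∀ᶠ x in (𝒰 : Filter α),
      SignType.sign (f x) = SignType.sign (f : Germ (𝒰 : Filter α) ℝ) := fun f => by
    rcases lt_trichotomy (f : Germ (𝒰 : Filter α) ℝ) 0 with h | h | h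
    · rw [sign_neg h]
      exact (Germ.coe_lt.1 h).mono fun x hx => sign_neg hx
    · rw [h, sign_zero]
      exact (Germ.coe_eq.1 h).mono fun x hx => by rw [hx]; exact sign_zero
    · rw [sign_pos h]
      exact (Germ.coe_lt.1 h).mono fun x hx => sign_pos hx
  constructor
  · intro h
    filter_upwards [key f, key g] with x hf hg
    rw [hf, hg, h]
  · intro h
    obtain ⟨x, h, hf, hg⟩ := (h.and ((key f).and (key g))).exists
    rw [← hf, ← hg, h]

/-- Near the origin a nonzero bivariate polynomial does not vanish on the graph of a flat nonzero
function. -/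
lemma not_eventually_bivariate_eq_zero_of_flat {l : Filter ℝ} [l.NeBot] (hl : l ≤ nhdsWithin 0 {0}ᶜ)
    {f : ℝ → ℝ} (hpos : ∀ᶠ x in l, 0 < f x) (hflat : ∀ N : ℕ, ∀ᶠ x in l, f x < |x| ^ N)
    {q : ℝ[X][X]} (hq : q ≠ 0) : ¬ ∀ᶠ x in l, (q.map (evalRingHom x)).eval (f x) = 0 := by
  intro hz
  have hl0 : Tendsto id l (nhds (0 : ℝ)) := hl.trans nhdsWithin_le_nhds
  have hne : ∀ᶠ x in l, x ≠ 0 := hl self_mem_nhdsWithin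
  have hquot : ∀ N : ℕ, Tendsto (fun x => f x / x ^ N) l (nhds 0) := fun N => by
    rw [tendsto_zero_iff_abs_tendsto_zero]
    refine squeeze_zero' (Eventually.of_forall fun x => abs_nonneg _) ?_
      (show Tendsto (fun x : ℝ => |x|) l (nhds 0) by simpa using hl0.abs)
    filter_upwards [hpos, hflat (N + 1), hne] with x h0 h1 h2
    have : 0 < |x| ^ N := by positivity
    simp only [Function.comp, abs_div, abs_pow]
    rw [div_le_iff₀ this, abs_of_pos h0, ← pow_succ']
    exact h1.le
  -- Write `q = Y^k q'` with `q'(x, 0) = x^N b(x)` and `b(0) ≠ 0`. Dividing `q(x, f x) = 0` by `(f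
  -- x)^k x^N` leaves `b(x)` plus a term that tends to zero by flatness, forcing `b(0) = 0`.
  obtain ⟨q', hq', hndvd⟩ := exists_eq_pow_rootMultiplicity_mul_and_not_dvd q hq 0
  set k := q.rootMultiplicity 0
  rw [C_0, sub_zero] at hq' hndvd
  rw [X_dvd_iff] at hndvd
  obtain ⟨b, hb, hbd⟩ := exists_eq_pow_rootMultiplicity_mul_and_not_dvd (q'.coeff 0) hndvd 0
  set N := (q'.coeff 0).rootMultiplicity 0
  rw [C_0, sub_zero] at hb hbd
  rw [X_dvd_iff, coeff_zero_eq_eval_zero] at hbd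
  have hb0 : Tendsto (fun x => b.eval x) l (nhds (b.eval 0)) := (b.continuous.tendsto 0).comp hl0
  have hd : Tendsto (fun x => ((q'.divX).map (evalRingHom x)).eval (f x)) l
      (nhds (((q'.divX).map (evalRingHom 0)).eval 0)) := by
    simp only [eval_map, eval₂_eq_sum_range]
    refine tendsto_finsetSum _ fun i _ => ?_
    have hf0 : Tendsto f l (nhds 0) := by simpa using hquot 0
    exact (((q'.divX.coeff i).continuous.tendsto 0).comp hl0).mul (hf0.pow i)
  have hlim := ((hquot N).mul hd).add hb0
  rw [zero_mul, zero_add] at hlim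
  have hzero : ∀ᶠ x in l, f x / x ^ N * ((q'.divX).map (evalRingHom x)).eval (f x) + b.eval x
      = 0 := by
    filter_upwards [hz, hpos, hne] with x h0 hfx hx
    rw [hq', ← divX_mul_X_add q', hb] at h0
    simp only [Polynomial.map_mul, Polynomial.map_pow, map_X, Polynomial.map_add, map_C, eval_mul,
      eval_pow, eval_X, eval_add, eval_C, coe_evalRingHom, mul_eq_zero, pow_eq_zero_iff',
      hfx.ne', false_and, false_or] at h0
    field_simp
    linarith
  exact hbd (tendsto_nhds_unique (hlim.congr' hzero) tendsto_const_nhds)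

end Germ

/-! ### The Łojasiewicz inequality for semialgebraic curves -/

/-- Membership in a semialgebraic set depends only on the signs of finitely many polynomials. -/
lemma IsSemialgebraic.exists_finset_sign {ι : Type} {A : Set (ι → ℝ)} (hA : IsSemialgebraic A) :
    ∃ G : Finset (MvPolynomial ι ℝ), ∀ z w : ι → ℝ,
      (∀ g ∈ G, SignType.sign (MvPolynomial.eval z g) = SignType.sign (MvPolynomial.eval w g)) →
      z ∈ A → w ∈ A := by
  classical
  induction hA with
  | pos f =>
    refine ⟨{f}, fun z w h hz => ?_⟩
    have := h f (Finset.mem_singleton_self f)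
    have hz : 0 < MvPolynomial.eval z f := hz
    rw [sign_pos hz] at this
    exact sign_eq_one_iff.1 this.symm
  | zero f =>
    refine ⟨{f}, fun z w h hz => ?_⟩
    have := h f (Finset.mem_singleton_self f)
    have hz : MvPolynomial.eval z f = 0 := hz
    rw [hz, sign_zero] at this
    exact sign_eq_zero_iff.1 this.symm
  | compl _ ih =>
    obtain ⟨G, hG⟩ := ih
    exact ⟨G, fun z w h hz hw => hz (hG w z (fun g hg => (h g hg).symm) hw)⟩
  | inter _ _ ih₁ ih₂ =>
    obtain ⟨G₁, h₁⟩ := ih₁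
    obtain ⟨G₂, h₂⟩ := ih₂
    refine ⟨G₁ ∪ G₂, fun z w h hz => ⟨h₁ z w (fun g hg => h g ?_) hz.1,
      h₂ z w (fun g hg => h g ?_) hz.2⟩⟩
    · exact Finset.mem_union_left _ hg
    · exact Finset.mem_union_right _ hg

open Filter in
/-- The germs of a semialgebraic map along an ultrafilter: a polynomial expression in the variable
and the components cannot be a flat nonzero function. -/
lemma IsSemialgebraicMapOn.not_flat {n : ℕ} {F : ℝ → EuclideanSpace ℝ (Fin n)} {U : Set ℝ}
    (hF : IsSemialgebraicMapOn F U) (H : MvPolynomial (Option (Fin n)) ℝ) {𝒰 : Ultrafilter ℝ}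
    (h0 : (𝒰 : Filter ℝ) ≤ nhdsWithin 0 {0}ᶜ) (hU : U ∈ 𝒰)
    (hpos : ∀ᶠ x in (𝒰 : Filter ℝ), 0 < MvPolynomial.eval (fun o => o.elim x (F x ·)) H) :
    ¬ ∀ N : ℕ, ∀ᶠ x in (𝒰 : Filter ℝ),
      MvPolynomial.eval (fun o => o.elim x (F x ·)) H < |x| ^ N := by
  classical
  intro hflat
  obtain ⟨G, hG⟩ := hF.exists_finset_sign
  let L := Germ (𝒰 : Filter ℝ) ℝ
  let Yf : Option (Fin n) → ℝ → ℝ := fun o x => o.elim x (F x ·)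
  let f : ℝ → ℝ := fun x => MvPolynomial.eval (fun o => Yf o x) H
  let Y : Option (Fin n) → L := fun o => (Yf o : L)
  let y : L := (f : L)
  let x₀ : L := Y none
  have hy : Transcendental (IntermediateField.adjoin ℝ {x₀}) y := by
    intro halg
    obtain ⟨q, hq, hqy⟩ := exists_bivariate_of_isAlgebraic_adjoin_simple halg
    refine not_eventually_bivariate_eq_zero_of_flat h0 hpos hflat hq ?_
    have hC : (aeval x₀ : ℝ[X] →ₐ[ℝ] L).toRingHom
        = (Germ.coeRingHom (𝒰 : Filter ℝ)).comp (RingHom.pi fun x => evalRingHom x) := by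
      refine Polynomial.ringHom_ext (fun r => ?_) ?_
      · refine (aeval_C x₀ r).trans ((Germ.algebraMap_real _ r).trans ?_)
        exact congrArg (Germ.ofFun (l := (𝒰 : Filter ℝ))) (funext fun x => (eval_C (x := x)).symm)
      · refine (aeval_X x₀).trans ?_
        exact congrArg (Germ.ofFun (l := (𝒰 : Filter ℝ))) (funext fun x => (eval_X (x := x)).symm)
    rw [hC, ← eval_map, ← Polynomial.map_map, Germ.eval_coe] at hqy
    have := Germ.coe_eq.1 (hqy.trans Germ.coe_zero.symm)
    filter_upwards [this] with x hx
    rw [Polynomial.map_map] at hx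
    exact hx
  obtain ⟨K, hyK, hK⟩ := exists_intermediateField_transcendental hy
  let x₁ : K := algebraMap (IntermediateField.adjoin ℝ {x₀}) K
    ⟨x₀, IntermediateField.subset_adjoin ℝ _ rfl⟩
  have hx₁ : algebraMap K L x₁ = x₀ := rfl
  let φ : ℝ →+* K := (algebraMap (IntermediateField.adjoin ℝ {x₀}) K).comp (algebraMap ℝ _)
  have hφ : (algebraMap K L).comp φ = algebraMap ℝ L := rfl
  have haeval : ∀ (Z : Option (Fin n) → L) (g : MvPolynomial (Option (Fin n)) ℝ),
      MvPolynomial.aeval Z (MvPolynomial.map φ g) = MvPolynomial.aeval Z g := fun Z g => by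
    rw [MvPolynomial.aeval_def, MvPolynomial.eval₂_map, hφ, MvPolynomial.aeval_def]
  -- Adding the polynomial `X none - C x₁`, which vanishes at `Y`, to the sign system forces the
  -- perturbed tuple to keep the source coordinate.
  obtain ⟨Y', hs, hH⟩ := exists_same_signs_of_transcendental
    (Germ.exists_isRoot_of_mul_neg 𝒰) hyK Y
    (insert (MvPolynomial.X none - MvPolynomial.C x₁) (G.image (MvPolynomial.map φ)))
  have hnone : Y' none = Y none := by
    have := hs _ (Finset.mem_insert_self _ _)
    simp only [map_sub, MvPolynomial.aeval_X, MvPolynomial.aeval_C] at this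
    rw [show Y none - algebraMap K _ x₁ = 0 from sub_self _, sign_zero, sign_eq_zero_iff,
      sub_eq_zero] at this
    exact this
  have hrep : ∀ o, ∃ Zf : ℝ → ℝ, (Zf : L) = Y' o := fun o =>
    Germ.inductionOn (Y' o) fun f => ⟨f, rfl⟩
  choose Zf hZf using hrep
  obtain rfl : (fun o => (Zf o : L)) = Y' := funext hZf
  have hsign : ∀ g ∈ G, ∀ᶠ x in (𝒰 : Filter ℝ),
      SignType.sign (MvPolynomial.eval (fun o => Yf o x) g)
        = SignType.sign (MvPolynomial.eval (fun o => Zf o x) g) := fun g hg => by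
    have := hs _ (Finset.mem_insert_of_mem (Finset.mem_image_of_mem _ hg))
    rw [haeval, haeval, Germ.aeval_coe, Germ.aeval_coe, Germ.sign_coe_eq_iff] at this
    exact this.mono fun x hx => hx.symm
  -- Almost everywhere the perturbed point lies on the graph of `F` over the same parameter, so the
  -- two tuples agree, contrary to the changed value of `H`.
  have heq : ∀ o, (Zf o : L) = Y o := fun o => by
    refine Germ.coe_eq.2 ?_
    filter_upwards [hU, (Filter.eventually_all_finset G).2 hsign, Germ.coe_eq.1 hnone]
      with x hxU hx hxn
    have hmem := hG _ _ hx ⟨hxU, fun i => rfl⟩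
    cases o with
    | none => exact hxn
    | some i =>
      have := hmem.2 i
      beta_reduce at this
      rw [hxn] at this
      exact this
  refine hH (MvPolynomial.map φ H) ?_ ?_
  · rw [haeval, Germ.aeval_coe]
  · rw [haeval, show (fun o => (Zf o : L)) = Y from funext heq, Germ.aeval_coe]

open Filter in
/-- A Łojasiewicz inequality: a polynomial expression in the components of a semialgebraic map of
one variable that is positive near the origin is bounded from below by a power of the variable. -/
theorem IsSemialgebraicMapOn.exists_pow_le {n : ℕ} {F : ℝ → EuclideanSpace ℝ (Fin n)} {U : Set ℝ}
    (hF : IsSemialgebraicMapOn F U) (H : MvPolynomial (Option (Fin n)) ℝ) {l : Filter ℝ}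
    (h0 : l ≤ nhdsWithin 0 {0}ᶜ) (hU : U ∈ l)
    (hpos : ∀ᶠ x in l, 0 < MvPolynomial.eval (fun o => o.elim x (F x ·)) H) :
    ∃ N : ℕ, ∀ᶠ x in l, |x| ^ N ≤ MvPolynomial.eval (fun o => o.elim x (F x ·)) H := by
  by_contra! hN
  set f : ℝ → ℝ := fun x => MvPolynomial.eval (fun o => o.elim x (F x ·)) H
  have h1 : ∀ᶠ x in l, |x| ≤ 1 := by
    have : Tendsto (fun x : ℝ => |x|) (nhds 0) (nhds 0) := by
      simpa using (continuous_abs : Continuous fun x : ℝ => |x|).tendsto 0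
    exact (h0.trans nhdsWithin_le_nhds) (this.eventually (Iic_mem_nhds one_pos))
  -- The condition `|x| ≤ 1` makes these filters decrease, so their infimum is proper and an
  -- ultrafilter below it sees every failure of the inequality at once.
  let A : ℕ → Filter ℝ := fun N => l ⊓ 𝓟 {x | |x| ≤ 1 ∧ f x < |x| ^ N}
  have hA : Antitone A := fun M N hMN =>
    inf_le_inf_left l (principal_mono.2 fun x hx =>
      ⟨hx.1, hx.2.trans_le (pow_le_pow_of_le_one (abs_nonneg x) hx.1 hMN)⟩)
  have hne : ∀ N, (A N).NeBot := fun N =>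
    frequently_mem_iff_neBot.1 (((hN N).and_eventually h1).mono fun x hx => ⟨hx.2, hx.1⟩)
  have : (⨅ N, A N).NeBot := iInf_neBot_of_directed' hA.directed_ge hne
  have hle : ∀ N, (Ultrafilter.of (⨅ N, A N) : Filter ℝ) ≤ A N := fun N =>
    (Ultrafilter.of_le _).trans (iInf_le _ N)
  have hl := (hle 0).trans inf_le_left
  refine hF.not_flat H (hl.trans h0) (hl hU) (hl hpos) fun N => ?_
  exact (hle N).trans inf_le_right (mem_principal.2 fun x hx => hx.2)

/-! ### Polynomial approximation with prescribed contact at nodes -/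

/-- Weierstrass approximation with interpolation: a continuous function that agrees with polynomials
near finitely many nodes is approximated by polynomials with an error that is small relative to a
prescribed power of the distance to the nodes. -/
theorem exists_polynomial_sub_le_prod_pow {ι : Type*} [Fintype ι] {τ : ι → ℝ}
    (hτ : Function.Injective τ) {f : ℝ → ℝ} (hf : Continuous f) (g : ι → ℝ[X])
    (hg : ∀ i, ∀ᶠ x in 𝓝 (τ i), f x = (g i).eval x) (N : ℕ) {ε : ℝ} (hε : 0 < ε) :
    ∃ P : ℝ[X], ∀ x ∈ Icc (0 : ℝ) 1, |P.eval x - f x| ≤ ε * |∏ i, (x - τ i) ^ N| := by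
  classical
  obtain ⟨H, hH⟩ := Ideal.exists_forall_sub_mem_ideal
    (I := fun i => Ideal.span {(X - C (τ i) : ℝ[X]) ^ N})
    (fun i j hij => (Ideal.isCoprime_span_singleton_iff _ _).2
      ((pairwise_coprime_X_sub_C hτ hij).pow)) g
  simp only [Ideal.mem_span_singleton] at hH
  choose k hk using hH
  let V : ι → ℝ → ℝ := fun i x => ∏ j ∈ Finset.univ.erase i, (x - τ j) ^ N
  have hV0 : ∀ i, V i (τ i) ≠ 0 := fun i => Finset.prod_ne_zero_iff.2 fun j hj =>
    pow_ne_zero _ (sub_ne_zero.2 fun h => (Finset.mem_erase.1 hj).1 (hτ h).symm)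
  have hWV : ∀ i x, ∏ j, (x - τ j) ^ N = (x - τ i) ^ N * V i x := fun i x =>
    (Finset.mul_prod_erase _ _ (Finset.mem_univ i)).symm
  -- The quotient of `f - H` by the nodal product, with its singularities removed: near `τ i` the
  -- factor `(x - τ i) ^ N` cancels, which gives the value at the node. Approximating `ρ` uniformly
  -- and multiplying back yields the weighted error.
  let ρ : ℝ → ℝ := Function.extend τ (fun i => -(k i).eval (τ i) / V i (τ i))
    (fun x => (f x - H.eval x) / ∏ j, (x - τ j) ^ N)
  have hρnode : ∀ i, ρ (τ i) = -(k i).eval (τ i) / V i (τ i) := fun i => hτ.extend_apply _ _ i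
  have hρ : ∀ x, (∀ i, x ≠ τ i) → ρ x = (f x - H.eval x) / ∏ j, (x - τ j) ^ N := fun x hx =>
    Function.extend_apply' _ _ _ (by rintro ⟨i, rfl⟩; exact hx i rfl)
  have hW0 : ∀ x, (∀ i, x ≠ τ i) → ∏ j, (x - τ j) ^ N ≠ 0 := fun x hx =>
    Finset.prod_ne_zero_iff.2 fun j _ => pow_ne_zero _ (sub_ne_zero.2 (hx j))
  have hdiff : ∀ i x, f x = (g i).eval x → f x - H.eval x = -((x - τ i) ^ N * (k i).eval x) := by
    intro i x hx
    have := congrArg (eval x) (hk i)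
    simp only [eval_sub, eval_mul, eval_pow, eval_X, eval_C] at this
    rw [hx]; linarith
  have hfac : ∀ x, f x - H.eval x = ρ x * ∏ j, (x - τ j) ^ N := fun x => by
    by_cases hx : ∃ i, x = τ i
    · obtain ⟨i, rfl⟩ := hx
      rw [hρnode, hWV i, hdiff i _ (hg i).self_of_nhds]
      have := hV0 i
      field_simp
    · rw [hρ x (by simpa using hx), div_mul_cancel₀ _ (hW0 x (by simpa using hx))]
  have hρc : Continuous ρ := continuous_iff_continuousAt.2 fun x => by
    by_cases hx : ∃ i, x = τ i
    · obtain ⟨i, rfl⟩ := hx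
      have hVc : Continuous (V i) := by fun_prop
      have hcq : ContinuousAt (fun x => -(k i).eval x / V i x) (τ i) :=
        ((k i).continuous.neg.continuousAt).div hVc.continuousAt (hV0 i)
      refine hcq.congr ?_
      have hne : ∀ᶠ x in 𝓝 (τ i), ∀ j, j ≠ i → x ≠ τ j := Filter.eventually_all.2 fun j => by
        by_cases hj : j = i
        · exact Filter.Eventually.of_forall fun x h => absurd hj h
        · filter_upwards [isOpen_ne.mem_nhds (fun h => hj (hτ h).symm : τ i ≠ τ j)] with x hx _
          exact hx
      filter_upwards [hg i, hne] with x hx hxn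
      by_cases hxi : x = τ i
      · rw [hxi, hρnode]
      · have hall : ∀ j, x ≠ τ j := fun j => by
          by_cases hj : j = i
          · rwa [hj]
          · exact hxn j hj
        have h1 : (x - τ i) ^ N ≠ 0 := pow_ne_zero _ (sub_ne_zero.2 hxi)
        rw [hρ x hall, hdiff i x hx, hWV i, neg_div, neg_div, mul_div_mul_left _ _ h1]
    · have hx' : ∀ i, x ≠ τ i := by simpa using hx
      have hcq : ContinuousAt (fun x => (f x - H.eval x) / ∏ j, (x - τ j) ^ N) x :=
        (hf.sub H.continuous).continuousAt.div (by fun_prop) (hW0 x hx')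
      refine hcq.congr ?_
      filter_upwards [Filter.eventually_all.2 fun i => isOpen_ne.mem_nhds (hx' i)] with y hy
      exact (hρ y hy).symm
  obtain ⟨R, hR⟩ := exists_polynomial_near_of_continuousOn 0 1 ρ hρc.continuousOn ε hε
  refine ⟨H + (∏ j, (X - C (τ j)) ^ N) * R, fun x hx => ?_⟩
  have : (H + (∏ j, (X - C (τ j)) ^ N) * R).eval x - f x
      = (R.eval x - ρ x) * ∏ j, (x - τ j) ^ N := by
    have := hfac x
    simp only [eval_add, eval_mul, eval_prod, eval_pow, eval_sub, eval_X, eval_C]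
    linear_combination -this
  rw [this, abs_mul]
  exact mul_le_mul_of_nonneg_right (hR x hx).le (abs_nonneg _)

lemma EuclideanSpace.norm_le_card_mul {n : ℕ} (v : EuclideanSpace ℝ (Fin n)) {c : ℝ}
    (h : ∀ i, |v i| ≤ c) : ‖v‖ ≤ n * c := by
  have h1 : ‖v‖ ≤ ∑ i, |v i| := by
    rw [EuclideanSpace.norm_eq]
    refine Real.sqrt_le_iff.2 ⟨Finset.sum_nonneg fun i _ => abs_nonneg _, ?_⟩
    exact Finset.sum_sq_le_sq_sum_of_nonneg fun i _ => norm_nonneg _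
  refine h1.trans ((Finset.sum_le_sum fun i _ => h i).trans ?_)
  simp

lemma continuous_polyPath {n : ℕ} (A : Fin n → ℝ[X]) : Continuous (polyPath A) := by
  unfold polyPath
  exact (PiLp.continuous_toLp 2 _).comp (continuous_pi fun i => (A i).continuous)

/-- A continuous path in the closures of open convex sets that change only at finitely many nodes is
approximated by polynomial paths that stay in the open sets off the nodes and interpolate at the
nodes, if there are local polynomial paths at the nodes that stay well inside the open sets. -/
theorem exists_polyPath_of_local {n : ℕ} {ι κ : Type*} [Fintype ι] {τ : ι → ℝ}
    (hτ : Function.Injective τ) (hτ01 : ∀ i, τ i ∈ Icc (0 : ℝ) 1)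
    {S : κ → Set (EuclideanSpace ℝ (Fin n))} (hSo : ∀ k, IsOpen (S k))
    (hSc : ∀ k, Convex ℝ (S k)) {idx : ℝ → κ}
    (hidx : ∀ x, (∀ i, x ≠ τ i) → ∀ᶠ y in 𝓝 x, idx y = idx x)
    {β : ℝ → EuclideanSpace ℝ (Fin n)} (hβ : Continuous β) (hβS : ∀ x, β x ∈ closure (S (idx x)))
    (g : ι → Fin n → ℝ[X]) (hg : ∀ i, polyPath (g i) (τ i) = β (τ i)) {N : ℕ} (hN : N ≠ 0)
    (hgS : ∀ i, ∀ᶠ x in 𝓝[≠] τ i, Metric.ball (polyPath (g i) x) (|x - τ i| ^ N) ⊆ S (idx x))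
    {ε : ℝ} (hε : 0 < ε) :
    ∃ A : Fin n → ℝ[X],
      (∀ x ∈ Icc (0 : ℝ) 1, (∀ i, x ≠ τ i) → polyPath A x ∈ S (idx x)) ∧
      (∀ i, polyPath A (τ i) = β (τ i)) ∧ ∀ x ∈ Icc (0 : ℝ) 1, ‖polyPath A x - β x‖ < ε := by
  -- a radius of neighbourhoods of the nodes that works for all nodes
  obtain ⟨r, hr0, hrg, hrsep⟩ : ∃ r > 0, (∀ i x, |x - τ i| < 2 * r →
      dist (polyPath (g i) x) (β x) < ε / 2 ∧
      (x ≠ τ i → Metric.ball (polyPath (g i) x) (|x - τ i| ^ N) ⊆ S (idx x))) ∧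
      ∀ i j, i ≠ j → 4 * r < |τ i - τ j| := by
    have h1 : ∀ i, ∀ᶠ r in 𝓝[>] (0 : ℝ), ∀ x, |x - τ i| < 2 * r →
        dist (polyPath (g i) x) (β x) < ε / 2 ∧
        (x ≠ τ i → Metric.ball (polyPath (g i) x) (|x - τ i| ^ N) ⊆ S (idx x)) := fun i => by
      have ha : ∀ᶠ x in 𝓝 (τ i), dist (polyPath (g i) x) (β x) < ε / 2 := by
        have := ((continuous_polyPath (g i)).dist hβ).tendsto (τ i)
        rw [hg, dist_self] at this
        exact this.eventually (gt_mem_nhds (half_pos hε))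
      obtain ⟨δ, hδ, h⟩ := Metric.eventually_nhds_iff.1
        (ha.and (eventually_nhdsWithin_iff.1 (hgS i)))
      filter_upwards [nhdsWithin_le_nhds (gt_mem_nhds (half_pos hδ))] with r hr x hx
      have hr : r < δ / 2 := hr
      exact h (by rw [Real.dist_eq]; linarith)
    have h2 : ∀ i j, ∀ᶠ r in 𝓝[>] (0 : ℝ), i ≠ j → 4 * r < |τ i - τ j| := fun i j => by
      by_cases hij : i = j
      · exact Filter.Eventually.of_forall fun r h => absurd hij h
      · have : 0 < |τ i - τ j| := abs_pos.2 (sub_ne_zero.2 (hτ.ne hij))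
        filter_upwards [nhdsWithin_le_nhds (gt_mem_nhds (div_pos this four_pos))] with r hr _
        have hr : r < |τ i - τ j| / 4 := hr
        linarith
    obtain ⟨r, ⟨ha, hb⟩, hr⟩ := (((Filter.eventually_all.2 h1).and
      (Filter.eventually_all.2 fun i => Filter.eventually_all.2 (h2 i))).and
      self_mem_nhdsWithin).exists
    exact ⟨r, hr, ha, hb⟩
  -- a continuous path with the required properties
  let T : ℝ → Set (EuclideanSpace ℝ (Fin n)) := fun x =>
    ((⋂ i, ⋂ (_ : |x - τ i| ≤ r), {polyPath (g i) x}) ∩ (⋂ (_ : ∀ i, x ≠ τ i), S (idx x))) ∩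
      Metric.ball (β x) (ε / 2)
  obtain ⟨α, hα⟩ : ∃ α : C(ℝ, EuclideanSpace ℝ (Fin n)), ∀ x, α x ∈ T x := by
    refine exists_continuous_forall_mem_convex_of_local (fun x => ?_) fun x => ?_
    · exact ((convex_iInter fun i => convex_iInter fun _ => convex_singleton _).inter
        (convex_iInter fun _ => hSc _)).inter (convex_ball _ _)
    by_cases hx : ∃ i, |x - τ i| ≤ r
    · obtain ⟨i, hi⟩ := hx
      refine ⟨{y | |y - τ i| < 2 * r}, IsOpen.mem_nhds ?_ ?_, polyPath (g i),
        (continuous_polyPath _).continuousOn, fun y hy => ⟨⟨?_, ?_⟩, ?_⟩⟩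
      · exact isOpen_lt (by fun_prop) continuous_const
      · change |x - τ i| < 2 * r
        linarith
      · simp only [mem_iInter, mem_singleton_iff]
        intro j hj
        by_cases hij : i = j
        · rw [hij]
        · have h1 := hrsep i j hij
          have h2 := abs_sub_le (τ i) y (τ j)
          rw [abs_sub_comm (τ i) y] at h2
          have hy : |y - τ i| < 2 * r := hy
          linarith
      · simp only [mem_iInter]
        intro hyn
        refine (hrg i y hy).2 (hyn i) (Metric.mem_ball_self ?_)
        have := abs_pos.2 (sub_ne_zero.2 (hyn i))
        positivity
      · exact (hrg i y hy).1
    · push Not at hx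
      have hxn : ∀ i, x ≠ τ i := fun i h => by
        have := hx i
        rw [h, sub_self, abs_zero] at this
        linarith
      obtain ⟨v, hv, hvd⟩ := Metric.mem_closure_iff.1 (hβS x) (ε / 2) (half_pos hε)
      rw [dist_comm] at hvd
      have h1 : ∀ᶠ y in 𝓝 x, dist v (β y) < ε / 2 :=
        ((continuous_const.dist hβ).tendsto x).eventually (gt_mem_nhds hvd)
      have h2 : ∀ i, ∀ᶠ y in 𝓝 x, r < |y - τ i| := fun i =>
        ((by fun_prop : Continuous fun y => |y - τ i|).tendsto x).eventually (lt_mem_nhds (hx i))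
      refine ⟨_, h1.and ((Filter.eventually_all.2 h2).and (hidx x hxn)), fun _ => v,
        continuousOn_const, fun y hy => ⟨⟨?_, ?_⟩, hy.1⟩⟩
      · simp only [mem_iInter]
        intro i hi
        exact absurd hi (not_le.2 (hy.2.1 i))
      · simp only [mem_iInter]
        intro _
        rw [hy.2.2]
        exact hv
  have hαg : ∀ i x, |x - τ i| ≤ r → α x = polyPath (g i) x := fun i x hx => by
    have := (hα x).1.1
    simp only [mem_iInter, mem_singleton_iff] at this
    exact this i hx
  have hαS : ∀ x, (∀ i, x ≠ τ i) → α x ∈ S (idx x) := fun x hx => by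
    have := (hα x).1.2
    simp only [mem_iInter] at this
    exact this hx
  have hαβ : ∀ x, ‖α x - β x‖ < ε / 2 := fun x => by
    rw [← dist_eq_norm]; exact (hα x).2
  let W : ℝ → ℝ := fun x => ∏ i, (x - τ i) ^ N
  have hfac1 : ∀ x ∈ Icc (0 : ℝ) 1, ∀ i, |(x - τ i) ^ N| ≤ 1 := fun x hx i => by
    rw [abs_pow]
    refine pow_le_one₀ (abs_nonneg _) ?_
    rw [abs_le]
    constructor <;> linarith [hx.1, hx.2, (hτ01 i).1, (hτ01 i).2]
  have hW1 : ∀ x ∈ Icc (0 : ℝ) 1, |W x| ≤ 1 := fun x hx => by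
    rw [Finset.abs_prod]
    exact Finset.prod_le_one (fun i _ => abs_nonneg _) fun i _ => hfac1 x hx i
  have hWi : ∀ x ∈ Icc (0 : ℝ) 1, ∀ i, |W x| ≤ |x - τ i| ^ N := fun x hx i => by
    classical
    rw [Finset.abs_prod, ← Finset.mul_prod_erase _ _ (Finset.mem_univ i), ← abs_pow]
    exact mul_le_of_le_one_right (abs_nonneg _)
      (Finset.prod_le_one (fun i _ => abs_nonneg _) fun i _ => hfac1 x hx i)
  -- a uniform relative margin
  obtain ⟨δ, hδ, hδS⟩ : ∃ δ > 0, ∀ y ∈ Icc (0 : ℝ) 1, (∀ i, y ≠ τ i) →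
      ∀ v, ‖v - α y‖ ≤ δ * |W y| → v ∈ S (idx y) := by
    have hlocal : ∀ x ∈ Icc (0 : ℝ) 1, ∃ δ > 0, ∀ᶠ y in 𝓝 x, y ∈ Icc (0 : ℝ) 1 →
        (∀ i, y ≠ τ i) → ∀ v, ‖v - α y‖ ≤ δ * |W y| → v ∈ S (idx y) := fun x hx => by
      by_cases hxn : ∃ i, x = τ i
      · obtain ⟨i, rfl⟩ := hxn
        -- Since `|W y| ≤ |y - τ i| ^ N` on `[0, 1]`, the factor `1 / 2` places `v` strictly inside
        -- the open ball.
        refine ⟨1 / 2, by norm_num, ?_⟩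
        have hnear : ∀ᶠ y in 𝓝 (τ i), |y - τ i| < r :=
          ((by fun_prop : Continuous fun y => |y - τ i|).tendsto (τ i)).eventually
            (gt_mem_nhds (by simpa using hr0))
        filter_upwards [hnear] with y hy hy01 hyn v hv
        refine (hrg i y (by linarith)).2 (hyn i) ?_
        rw [Metric.mem_ball, dist_eq_norm, ← hαg i y hy.le]
        have h1 : 0 < |y - τ i| ^ N := by
          have := abs_pos.2 (sub_ne_zero.2 (hyn i))
          positivity
        linarith [hWi y hy01 i]
      · have hxn' : ∀ i, x ≠ τ i := by simpa using hxn
        obtain ⟨δ, hδ, hball⟩ := Metric.isOpen_iff.1 (hSo (idx x)) _ (hαS x hxn')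
        refine ⟨δ / 2, half_pos hδ, ?_⟩
        have hnear : ∀ᶠ y in 𝓝 x, dist (α y) (α x) < δ / 2 :=
          α.continuous.continuousAt.eventually (Metric.ball_mem_nhds _ (half_pos hδ))
        filter_upwards [hnear, hidx x hxn'] with y hy hyi hy01 _ v hv
        rw [hyi]
        refine hball ?_
        rw [Metric.mem_ball]
        have h1 := dist_triangle v (α y) (α x)
        rw [dist_eq_norm v (α y)] at h1
        have h2 : δ / 2 * |W y| ≤ δ / 2 := mul_le_of_le_one_right (half_pos hδ).le (hW1 y hy01)
        linarith
    have hmono : ∀ δ₁ δ₂ y, δ₁ ≤ δ₂ → (∀ v, ‖v - α y‖ ≤ δ₂ * |W y| → v ∈ S (idx y)) →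
        ∀ v, ‖v - α y‖ ≤ δ₁ * |W y| → v ∈ S (idx y) := fun δ₁ δ₂ y h12 h v hv =>
      h v (hv.trans (mul_le_mul_of_nonneg_right h12 (abs_nonneg _)))
    refine IsCompact.induction_on (p := fun s => ∃ δ > 0, ∀ y ∈ s, (∀ i, y ≠ τ i) →
      ∀ v, ‖v - α y‖ ≤ δ * |W y| → v ∈ S (idx y)) isCompact_Icc ⟨1, one_pos, by simp⟩ ?_ ?_ ?_
    · rintro s t hst ⟨δ, hδ, h⟩
      exact ⟨δ, hδ, fun y hy => h y (hst hy)⟩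
    · rintro s t ⟨δ₁, h₁, hs⟩ ⟨δ₂, h₂, ht⟩
      refine ⟨min δ₁ δ₂, lt_min h₁ h₂, fun y hy hyn => ?_⟩
      rcases hy with hy | hy
      · exact hmono _ _ y (min_le_left _ _) (hs y hy hyn)
      · exact hmono _ _ y (min_le_right _ _) (ht y hy hyn)
    · intro x hx
      obtain ⟨δ, hδ, h⟩ := hlocal x hx
      exact ⟨_, Filter.inter_mem (mem_nhdsWithin_of_mem_nhds h) self_mem_nhdsWithin, δ, hδ,
        fun y hy => hy.1 hy.2⟩
  -- polynomial approximation
  let η := min δ (ε / 2)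
  have hη : 0 < η := lt_min hδ (half_pos hε)
  -- The coordinate errors are summed over `n` terms; dividing by `n + 1` also covers `n = 0`.
  have hn : (0 : ℝ) < n + 1 := by positivity
  have happ : ∀ c : Fin n, ∃ P : ℝ[X], ∀ x ∈ Icc (0 : ℝ) 1,
      |P.eval x - α x c| ≤ η / (n + 1) * |∏ i, (x - τ i) ^ N| := fun c => by
    refine exists_polynomial_sub_le_prod_pow hτ (by fun_prop) (fun i => g i c)
      (fun i => ?_) N (by positivity)
    have hnear : ∀ᶠ y in 𝓝 (τ i), |y - τ i| < r :=
      ((by fun_prop : Continuous fun y => |y - τ i|).tendsto (τ i)).eventually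
        (gt_mem_nhds (by simpa using hr0))
    filter_upwards [hnear] with y hy
    rw [hαg i y hy.le]
    rfl
  choose A hA using happ
  have hAα : ∀ x ∈ Icc (0 : ℝ) 1, ‖polyPath A x - α x‖ ≤ η * |W x| := fun x hx => by
    refine (EuclideanSpace.norm_le_card_mul _ fun c => hA c x hx).trans ?_
    rw [← mul_assoc]
    refine mul_le_mul_of_nonneg_right ?_ (abs_nonneg _)
    rw [mul_div_assoc', div_le_iff₀ hn]
    nlinarith
  refine ⟨A, fun x hx hxn => ?_, fun i => ?_, fun x hx => ?_⟩
  · exact hδS x hx hxn _ ((hAα x hx).trans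
      (mul_le_mul_of_nonneg_right (min_le_left _ _) (abs_nonneg _)))
  · have h1 := hAα (τ i) (hτ01 i)
    have h2 : W (τ i) = 0 := Finset.prod_eq_zero (Finset.mem_univ i) (by simp [hN])
    rw [h2, abs_zero, mul_zero] at h1
    rw [← hg i, ← hαg i (τ i) (by simpa using hr0.le)]
    exact sub_eq_zero.1 (norm_le_zero_iff.1 h1)
  · have h1 := hAα x hx
    have h2 : η * |W x| ≤ ε / 2 :=
      (mul_le_of_le_one_right hη.le (hW1 x hx)).trans (min_le_right _ _)
    have h3 := norm_sub_le_norm_sub_add_norm_sub (polyPath A x) (α x) (β x)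
    linarith [hαβ x]

/-! ### Local polynomial paths with a power margin -/

/-- The interior of a full-dimensional polyhedron is a nonempty finite intersection of open
half-spaces. -/
lemma IsPolyhedronInterior.exists_eq_pos {n : ℕ} {S : Set (EuclideanSpace ℝ (Fin n))}
    (hS : IsPolyhedronInterior S) :
    ∃ (J : Type) (_ : Fintype J) (h : J → EuclideanSpace ℝ (Fin n) →ᵃ[ℝ] ℝ),
      S = {x | ∀ j, 0 < h j x} := by
  classical
  obtain ⟨K, ⟨k, h, hK⟩, hspan, rfl⟩ := hS
  have hKc : Convex ℝ K := by
    rw [hK, ofPred_forall]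
    exact convex_iInter fun j => (convex_Ici (𝕜 := ℝ) (0 : ℝ)).affine_preimage (h j)
  obtain ⟨c, hc⟩ := hKc.interior_nonempty_iff_affineSpan_eq_top.2 hspan
  have hcont : ∀ j, Continuous (h j) := fun j => (h j).continuous_of_finiteDimensional
  -- Constant inequalities are dropped, as they may read `0 ≤ 0`. A nonconstant affine function
  -- cannot vanish at an interior point, which would be a local minimum.
  refine ⟨{j // (h j).linear ≠ 0}, inferInstance, fun j => h j, Subset.antisymm ?_ ?_⟩
  · rintro x hx ⟨j, hj⟩
    have h0 : 0 ≤ h j x := by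
      have := interior_subset hx
      rw [hK] at this
      exact this j
    refine lt_of_le_of_ne h0 fun h0 => hj ?_
    have hmin : IsLocalMin (h j) x := by
      filter_upwards [isOpen_interior.mem_nhds hx] with y hy
      have := interior_subset hy
      rw [hK] at this
      rw [← h0]
      exact this j
    ext v
    let L : ℝ → ℝ := fun r => r * (h j).linear v
    have hL : ∀ r, h j (x + r • v) = r * (h j).linear v := fun r => by
      have := (h j).map_vadd x (r • v)
      rw [vadd_eq_add, vadd_eq_add, add_comm] at this
      rw [this, ← h0, map_smul, smul_eq_mul, add_zero]
    have htend : Filter.Tendsto (fun r : ℝ => x + r • v) (𝓝 0) (𝓝 x) := by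
      have : Continuous (fun r : ℝ => x + r • v) := by fun_prop
      simpa using this.tendsto 0
    have hev := htend.eventually hmin
    obtain ⟨ε, hε, hball⟩ := Metric.eventually_nhds_iff.1 hev
    have h1 := hball (y := ε / 2) (by rw [Real.dist_eq, sub_zero, abs_of_pos] <;> linarith)
    have h2 := hball (y := -(ε / 2)) (by rw [Real.dist_eq, sub_zero, abs_neg, abs_of_pos] <;> linarith)
    rw [hL, ← h0] at h1 h2
    simp only [LinearMap.zero_apply]
    nlinarith
  · have hopen : IsOpen {x | ∀ j : {j // (h j).linear ≠ 0}, 0 < h j x} := by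
      rw [ofPred_forall]
      exact isOpen_iInter_of_finite fun j => isOpen_lt continuous_const (hcont j)
    refine interior_maximal (fun x hx => ?_) hopen
    rw [hK]
    intro j
    by_cases hj : (h j).linear = 0
    · have hcj : 0 ≤ h j c := by
        have := interior_subset hc
        rw [hK] at this
        exact this j
      have : h j x = h j c := by
        have := (h j).linearMap_vsub x c
        rw [hj] at this
        simpa [sub_eq_zero, eq_comm (a := (0 : ℝ))] using this
      rwa [this]
    · exact (hx ⟨j, hj⟩).le

lemma IsPolyhedronInterior.isOpen {n : ℕ} {S : Set (EuclideanSpace ℝ (Fin n))}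
    (hS : IsPolyhedronInterior S) : IsOpen S := by
  obtain ⟨K, _, _, rfl⟩ := hS
  exact isOpen_interior

lemma IsPolyhedronInterior.convex {n : ℕ} {S : Set (EuclideanSpace ℝ (Fin n))}
    (hS : IsPolyhedronInterior S) : Convex ℝ S := by
  obtain ⟨J, _, h, rfl⟩ := hS.exists_eq_pos
  rw [ofPred_forall]
  exact convex_iInter fun j => (convex_Ioi (𝕜 := ℝ) (0 : ℝ)).affine_preimage (h j)

/-- A point at which all the defining affine functions are large is far from the complement. -/
lemma exists_ball_subset_of_le_affine {n : ℕ} {J : Type} [Fintype J]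
    (h : J → EuclideanSpace ℝ (Fin n) →ᵃ[ℝ] ℝ) :
    ∃ C > 0, ∀ v r, (∀ j, C * r ≤ h j v) → Metric.ball v r ⊆ {x | ∀ j, 0 < h j x} := by
  let L : J → EuclideanSpace ℝ (Fin n) →L[ℝ] ℝ := fun j => (h j).linear.toContinuousLinearMap
  have hL : 0 ≤ ∑ j, ‖L j‖ := Finset.sum_nonneg fun j _ => norm_nonneg _
  refine ⟨1 + ∑ j, ‖L j‖, by positivity, fun v r hr w hw j => ?_⟩
  have hdiff : h j w = h j v + L j (w - v) := by
    have := (h j).linearMap_vsub w v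
    simp only [vsub_eq_sub] at this
    change _ = _ + (h j).linear (w - v)
    rw [this]; ring
  have h1 := (L j).le_opNorm (w - v)
  rw [Real.norm_eq_abs] at h1
  have h2 : ‖w - v‖ < r := by rwa [← dist_eq_norm]
  have h3 : ‖L j‖ ≤ ∑ j, ‖L j‖ :=
    Finset.single_le_sum (f := fun j => ‖L j‖) (fun j _ => norm_nonneg _) (Finset.mem_univ j)
  have h4 := hr j
  have h5 : ‖L j‖ * ‖w - v‖ ≤ (∑ j, ‖L j‖) * r :=
    mul_le_mul h3 h2.le (norm_nonneg _) hL
  have h6 : 0 < r := (norm_nonneg _).trans_lt h2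
  rw [hdiff]
  linarith [neg_abs_le (L j (w - v))]

/-- Affine functions are polynomials. -/
lemma AffineMap.exists_mvPolynomial {n : ℕ} (h : EuclideanSpace ℝ (Fin n) →ᵃ[ℝ] ℝ) :
    ∃ H : MvPolynomial (Option (Fin n)) ℝ, ∀ (x : ℝ) (v : EuclideanSpace ℝ (Fin n)),
      MvPolynomial.eval (fun o => o.elim x (v ·)) H = h v := by
  refine ⟨MvPolynomial.C (h 0) + ∑ c, MvPolynomial.C (h.linear (EuclideanSpace.single c 1))
    * MvPolynomial.X (some c), fun x v => ?_⟩
  have h1 : h v = h.linear v + h 0 := by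
    have := h.map_vadd 0 v
    simpa using this
  have h2 : v = ∑ c, v c • EuclideanSpace.single c (1 : ℝ) := by
    ext i
    simp [Pi.single_apply]
  rw [h1]
  conv_rhs => rw [h2]
  simp [map_sum, add_comm, mul_comm]

lemma eventually_abs_sub_pow_le {N M : ℕ} (hNM : N ≤ M) (a : ℝ) :
    ∀ᶠ x in 𝓝 a, |x - a| ^ M ≤ |x - a| ^ N := by
  have : ∀ᶠ x in 𝓝 a, |x - a| < 1 :=
    ((by fun_prop : Continuous fun y => |y - a|).tendsto a).eventually (gt_mem_nhds (by simp))
  filter_upwards [this] with x hx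
  exact pow_le_pow_of_le_one (abs_nonneg _) hx.le hNM

lemma eventually_mul_abs_pow_succ_le (C : ℝ) (N : ℕ) :
    ∀ᶠ x in 𝓝 (0 : ℝ), C * |x| ^ (N + 1) ≤ |x| ^ N := by
  have : ∀ᶠ x in 𝓝 (0 : ℝ), C * |x| < 1 :=
    ((by fun_prop : Continuous fun y : ℝ => C * |y|).tendsto 0).eventually (gt_mem_nhds (by simp))
  filter_upwards [this] with x hx
  rw [pow_succ']
  have : 0 ≤ |x| ^ N := by positivity
  nlinarith

/-- A semialgebraic curve in an open polyhedron approaches the boundary at most as fast as a power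
of the parameter. -/
lemma IsSemialgebraicMapOn.exists_ball_pow_subset {n : ℕ} {F : ℝ → EuclideanSpace ℝ (Fin n)}
    {U : Set ℝ} (hF : IsSemialgebraicMapOn F U) {S : Set (EuclideanSpace ℝ (Fin n))}
    (hS : IsPolyhedronInterior S) {l : Filter ℝ} (h0 : l ≤ 𝓝[≠] 0) (hU : U ∈ l)
    (hFS : ∀ᶠ x in l, F x ∈ S) :
    ∃ N : ℕ, ∀ᶠ x in l, Metric.ball (F x) (|x| ^ N) ⊆ S := by
  obtain ⟨J, _, h, rfl⟩ := hS.exists_eq_pos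
  obtain ⟨C, hC, hball⟩ := exists_ball_subset_of_le_affine h
  have hj : ∀ j, ∃ N : ℕ, ∀ᶠ x in l, |x| ^ N ≤ h j (F x) := fun j => by
    obtain ⟨H, hH⟩ := (h j).exists_mvPolynomial
    have := hF.exists_pow_le H h0 hU (hFS.mono fun x hx => by rw [hH]; exact hx j)
    simpa only [hH] using this
  choose N hN using hj
  -- The supremum serves all faces at once, and the extra power of `|x|` absorbs the constant `C`.
  refine ⟨Finset.univ.sup N + 1, ?_⟩
  have h0' : l ≤ 𝓝 0 := h0.trans nhdsWithin_le_nhds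
  have hle : ∀ j, ∀ᶠ x in l, |x| ^ Finset.univ.sup N ≤ |x| ^ N j := fun j => by
    have := eventually_abs_sub_pow_le (Finset.le_sup (f := N) (Finset.mem_univ j)) 0
    simp only [sub_zero] at this
    exact h0' this
  filter_upwards [Filter.eventually_all.2 hN, Filter.eventually_all.2 hle,
    h0' (eventually_mul_abs_pow_succ_le C (Finset.univ.sup N))] with x h1 h2 h3
  exact hball _ _ fun j => h3.trans ((h2 j).trans (h1 j))

/-- Smooth curves are approximated by polynomial curves to any order at a point. -/
lemma exists_polyPath_sub_le_pow {n : ℕ} {F : ℝ → EuclideanSpace ℝ (Fin n)} {U : Set ℝ}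
    (hU : IsOpen U) (h0 : 0 ∈ U) (hF : ContDiffOn ℝ ∞ F U) (N : ℕ) :
    ∃ g : Fin n → ℝ[X], polyPath g 0 = F 0 ∧ ∀ᶠ x in 𝓝 (0 : ℝ), ‖F x - polyPath g x‖ ≤ |x| ^ N := by
  obtain ⟨δ, hδ, hball⟩ := Metric.isOpen_iff.1 hU 0 h0
  set s : Set ℝ := Metric.ball 0 δ
  have h0s : (0 : ℝ) ∈ s := Metric.mem_ball_self hδ
  let g : Fin n → ℝ[X] := fun c => ∑ k ∈ Finset.range (N + 1),
    C (((k.factorial : ℝ)⁻¹) * iteratedDerivWithin k F s 0 c) * X ^ k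
  have hg : ∀ x, polyPath g x = taylorWithinEval F N s 0 x := fun x => by
    rw [taylor_within_apply]
    ext c
    simp only [polyPath, g, eval_finsetSum, eval_mul, eval_C, eval_pow, eval_X, sub_zero,
      WithLp.ofLp_sum, Finset.sum_apply, PiLp.smul_apply, smul_eq_mul]
    exact Finset.sum_congr rfl fun k _ => by ring
  refine ⟨g, by rw [hg, taylorWithinEval_self], ?_⟩
  have hT := taylor_isLittleO (n := N) (convex_ball 0 δ) h0s
    ((hF.mono hball).of_le (by exact_mod_cast le_top))
  rw [IsOpen.nhdsWithin_eq Metric.isOpen_ball h0s] at hT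
  filter_upwards [hT.bound one_pos] with x hx
  rw [hg]
  simpa using hx

/-- A Nash bridge between two open polyhedra can be replaced by a polynomial one near its base
point. -/
lemma IsNashBridge.exists_polyPath {n : ℕ} {S T Γ : Set (EuclideanSpace ℝ (Fin n))}
    {q : EuclideanSpace ℝ (Fin n)} (hq : IsNashBridge S T Γ q) (hS : IsPolyhedronInterior S)
    (hT : IsPolyhedronInterior T) (a : ℝ) :
    ∃ (g : Fin n → ℝ[X]) (N : ℕ), polyPath g a = q ∧
      (∀ᶠ x in 𝓝[<] a, Metric.ball (polyPath g x) (|x - a| ^ N) ⊆ S) ∧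
      (∀ᶠ x in 𝓝[>] a, Metric.ball (polyPath g x) (|x - a| ^ N) ⊆ T) := by
  obtain ⟨γ, ⟨U, F, hUo, -, hIU, hFs, hFa, hFγ⟩, hγS, hγT, -, hγ0⟩ := hq
  have hI0 : (0 : ℝ) ∈ Icc (-1 : ℝ) 1 := by constructor <;> norm_num
  have hU0 : U ∈ 𝓝 (0 : ℝ) := hUo.mem_nhds (hIU hI0)
  have hS' : ∀ᶠ x in 𝓝[<] (0 : ℝ), F x ∈ S := by
    filter_upwards [Ico_mem_nhdsLT (by norm_num : (-1 : ℝ) < 0)] with x hx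
    rw [hFγ ⟨hx.1, by linarith [hx.2]⟩]
    exact hγS ⟨x, hx, rfl⟩
  have hT' : ∀ᶠ x in 𝓝[>] (0 : ℝ), F x ∈ T := by
    filter_upwards [Ioc_mem_nhdsGT (by norm_num : (0 : ℝ) < 1)] with x hx
    rw [hFγ ⟨by linarith [hx.1], hx.2⟩]
    exact hγT ⟨x, hx, rfl⟩
  obtain ⟨N₁, h₁⟩ := hFa.exists_ball_pow_subset hS
    (nhdsWithin_mono _ fun x (hx : x < 0) => hx.ne) (nhdsWithin_le_nhds hU0) hS'
  obtain ⟨N₂, h₂⟩ := hFa.exists_ball_pow_subset hT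
    (nhdsWithin_mono _ fun x (hx : 0 < x) => hx.ne') (nhdsWithin_le_nhds hU0) hT'
  set M := max N₁ N₂
  -- Taylor error and new radius are each at most `|x| ^ (M + 1)`; their sum is at most `|x| ^ M`
  -- near zero, within both margins.
  obtain ⟨g, hg0, hg⟩ := exists_polyPath_sub_le_pow hUo (hIU hI0) hFs (M + 1)
  have key : ∀ N ≤ M, ∀ᶠ x in 𝓝 (0 : ℝ),
      Metric.ball (polyPath g x) (|x| ^ (M + 1)) ⊆ Metric.ball (F x) (|x| ^ N) := fun N hN => by
    have hle := eventually_abs_sub_pow_le hN 0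
    simp only [sub_zero] at hle
    filter_upwards [hg, hle, eventually_mul_abs_pow_succ_le 2 M] with x h1 h2 h3
    refine Metric.ball_subset_ball' ?_
    rw [dist_comm, dist_eq_norm]
    linarith
  have htrans : ∀ x, polyPath (fun c => (g c).comp (X - C a)) x = polyPath g (x - a) := fun x => by
    ext c; simp [polyPath]
  have hlt : Filter.Tendsto (fun x => x - a) (𝓝[<] a) (𝓝[<] 0) := by
    refine tendsto_nhdsWithin_iff.2 ⟨?_, ?_⟩
    · have : Continuous fun x : ℝ => x - a := by fun_prop
      simpa using (this.tendsto a).mono_left nhdsWithin_le_nhds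
    · filter_upwards [self_mem_nhdsWithin] with x (hx : x < a)
      exact sub_neg.2 hx
  have hgt : Filter.Tendsto (fun x => x - a) (𝓝[>] a) (𝓝[>] 0) := by
    refine tendsto_nhdsWithin_iff.2 ⟨?_, ?_⟩
    · have : Continuous fun x : ℝ => x - a := by fun_prop
      simpa using (this.tendsto a).mono_left nhdsWithin_le_nhds
    · filter_upwards [self_mem_nhdsWithin] with x (hx : a < x)
      exact sub_pos.2 hx
  refine ⟨fun c => (g c).comp (X - C a), M + 1, ?_, ?_, ?_⟩
  · rw [htrans, sub_self, hg0, hFγ hI0, hγ0]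
  · simp only [htrans]
    refine hlt.eventually (p := fun x => Metric.ball (polyPath g x) (|x| ^ (M + 1)) ⊆ S) ?_
    filter_upwards [h₁, nhdsWithin_le_nhds (key N₁ (le_max_left _ _))] with x h1 h2
    exact h2.trans h1
  · simp only [htrans]
    refine hgt.eventually (p := fun x => Metric.ball (polyPath g x) (|x| ^ (M + 1)) ⊆ T) ?_
    filter_upwards [h₂, nhdsWithin_le_nhds (key N₂ (le_max_right _ _))] with x h1 h2
    exact h2.trans h1

lemma IsNashBridge.mem_closure {n : ℕ} {S T Γ : Set (EuclideanSpace ℝ (Fin n))}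
    {q : EuclideanSpace ℝ (Fin n)} (hq : IsNashBridge S T Γ q) : q ∈ closure S ∧ q ∈ closure T := by
  obtain ⟨γ, ⟨U, F, hUo, -, hIU, hFs, -, hFγ⟩, hγS, hγT, -, hγ0⟩ := hq
  have hI0 : (0 : ℝ) ∈ Icc (-1 : ℝ) 1 := by constructor <;> norm_num
  have hc : Filter.Tendsto F (𝓝 0) (𝓝 q) := by
    have := hFs.continuousOn.continuousAt (hUo.mem_nhds (hIU hI0))
    rw [ContinuousAt, hFγ hI0, hγ0] at this
    exact this
  constructor
  · refine mem_closure_of_tendsto (hc.mono_left (nhdsWithin_le_nhds (s := Iio 0))) ?_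
    filter_upwards [Ico_mem_nhdsLT (by norm_num : (-1 : ℝ) < 0)] with x hx
    rw [hFγ ⟨hx.1, by linarith [hx.2]⟩]
    exact hγS ⟨x, hx, rfl⟩
  · refine mem_closure_of_tendsto (hc.mono_left (nhdsWithin_le_nhds (s := Ioi 0))) ?_
    filter_upwards [Ioc_mem_nhdsGT (by norm_num : (0 : ℝ) < 1)] with x hx
    rw [hFγ ⟨by linarith [hx.1], hx.2⟩]
    exact hγT ⟨x, hx, rfl⟩

/-- A polynomial path that touches a given point of the closure of an open convex set and is inside
the set at the nearby times. -/
lemma exists_polyPath_touching {n : ℕ} {S : Set (EuclideanSpace ℝ (Fin n))} (hSo : IsOpen S)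
    (hSc : Convex ℝ S) {p : EuclideanSpace ℝ (Fin n)} (hp : p ∈ closure S) (a : ℝ) :
    ∃ g : Fin n → ℝ[X], polyPath g a = p ∧
      ∀ᶠ x in 𝓝[≠] a, Metric.ball (polyPath g x) (|x - a| ^ 3) ⊆ S := by
  obtain ⟨c, hc⟩ : S.Nonempty := closure_nonempty_iff.1 ⟨p, hp⟩
  obtain ⟨r, hr, hball⟩ := Metric.isOpen_iff.1 hSo c hc
  -- The even exponent makes the path enter `S` on both sides of `a`. Its margin is of order `r * (x
  -- - a) ^ 2`, which exceeds `|x - a| ^ 3` near `a`.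
  let g : Fin n → ℝ[X] := fun i => C (p i) + (X - C a) ^ 2 * C (c i - p i)
  have hg : ∀ x, polyPath g x = p + (x - a) ^ 2 • (c - p) := fun x => by
    ext i; simp [polyPath, g]
  refine ⟨g, by simp [hg], ?_⟩
  have hnear : ∀ᶠ x in 𝓝[≠] a, |x - a| < min 1 r :=
    nhdsWithin_le_nhds (((by fun_prop : Continuous fun y => |y - a|).tendsto a).eventually
      (gt_mem_nhds (by simp [hr])))
  filter_upwards [hnear, self_mem_nhdsWithin] with x hx hxa
  have hxa : 0 < |x - a| := abs_pos.2 (sub_ne_zero.2 hxa)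
  have hx1 := hx.trans_le (min_le_left _ _)
  have hxr := hx.trans_le (min_le_right _ _)
  intro w hw
  rw [Metric.mem_ball, dist_eq_norm, hg] at hw
  set b := (x - a) ^ 2 with hb
  have hbabs : b = |x - a| ^ 2 := (sq_abs _).symm
  have hb0 : 0 < b := by rw [hbabs]; positivity
  have hb1 : b ≤ 1 := by rw [hbabs]; exact pow_le_one₀ (abs_nonneg _) hx1.le
  -- With `b = (x - a) ^ 2`, the point `w` is `(1 - b) p + b v` for this `v` near `c`, hence lies in
  -- `S` by convexity.
  have hv : c + b⁻¹ • (w - (p + b • (c - p))) ∈ S := by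
    refine hball ?_
    rw [Metric.mem_ball, dist_eq_norm, add_sub_cancel_left, norm_smul, norm_inv, Real.norm_eq_abs,
      abs_of_pos hb0, inv_mul_lt_iff₀ hb0]
    refine hw.trans_le ?_
    rw [pow_succ, ← hbabs]
    exact mul_le_mul_of_nonneg_left hxr.le hb0.le
  have hcomb := hSc.combo_closure_interior_mem_interior hp (hSo.interior_eq.symm ▸ hv)
    (sub_nonneg.2 hb1) hb0 (by ring)
  rw [hSo.interior_eq] at hcomb
  convert! hcomb using 1
  rw [smul_add, smul_inv_smul₀ hb0.ne']
  module

/-! ### Nash maps that are affine on finitely many intervals -/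

section Semialgebraic

variable {ι : Type}

lemma IsSemialgebraic.univ : IsSemialgebraic (univ : Set (ι → ℝ)) := by
  have := IsSemialgebraic.zero (0 : MvPolynomial ι ℝ)
  simpa using this

lemma IsSemialgebraic.iInter {κ : Type*} [Finite κ] {A : κ → Set (ι → ℝ)}
    (hA : ∀ k, IsSemialgebraic (A k)) : IsSemialgebraic (⋂ k, A k) := by
  have := Fintype.ofFinite κ
  have key : ∀ s : Finset κ, IsSemialgebraic (⋂ k ∈ s, A k) := fun s => by
    classical
    induction s using Finset.induction_on with
    | empty => simpa using IsSemialgebraic.univ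
    | insert a s _ ih => rw [Finset.set_biInter_insert]; exact (hA a).inter ih
  simpa using key Finset.univ

lemma IsSemialgebraic.iUnion {κ : Type*} [Finite κ] {A : κ → Set (ι → ℝ)}
    (hA : ∀ k, IsSemialgebraic (A k)) : IsSemialgebraic (⋃ k, A k) := by
  rw [← compl_compl (⋃ k, A k), compl_iUnion]
  exact (IsSemialgebraic.iInter fun k => (hA k).compl).compl

lemma IsSemialgebraic.coord_mem_Ioo (i : ι) (a b : ℝ) :
    IsSemialgebraic {z : ι → ℝ | z i ∈ Ioo a b} := by
  have h := (IsSemialgebraic.pos (MvPolynomial.X i - MvPolynomial.C a)).inter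
    (IsSemialgebraic.pos (MvPolynomial.C b - MvPolynomial.X i))
  convert! h using 1
  ext z
  simp

end Semialgebraic

/-- A map which is affine on each of finitely many open intervals is Nash on their union. -/
lemma isNashOn_of_affine_on_Ioo {n : ℕ} {κ : Type*} [Finite κ] (a b : κ → ℝ)
    (u v : κ → EuclideanSpace ℝ (Fin n)) (F f : ℝ → EuclideanSpace ℝ (Fin n)) {X : Set ℝ}
    (hF : ∀ k, ∀ x ∈ Ioo (a k) (b k), F x = u k + x • v k) (hX : X ⊆ ⋃ k, Ioo (a k) (b k))
    (hFf : EqOn F f X) : IsNashOn f X := by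
  refine ⟨⋃ k, Ioo (a k) (b k), F, isOpen_iUnion fun k => isOpen_Ioo, ?_, hX, ?_, ?_, hFf⟩
  · have h := IsSemialgebraic.iUnion fun k => IsSemialgebraic.coord_mem_Ioo () (a k) (b k)
    unfold IsSemialgebraicLine
    convert! h using 1
    ext z
    simp
  · intro x hx
    obtain ⟨k, hk⟩ := mem_iUnion.1 hx
    have hsm : ContDiff ℝ ∞ fun x : ℝ => u k + x • v k := by fun_prop
    refine (hsm.contDiffAt.congr_of_eventuallyEq ?_).contDiffWithinAt
    filter_upwards [isOpen_Ioo.mem_nhds hk] with y hy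
    exact hF k y hy
  · have h := IsSemialgebraic.iUnion fun k =>
      (IsSemialgebraic.coord_mem_Ioo (none : Option (Fin n)) (a k) (b k)).inter
      (IsSemialgebraic.iInter fun i : Fin n => IsSemialgebraic.zero
        (MvPolynomial.X (some i) - (MvPolynomial.C (u k i)
          + MvPolynomial.X none * MvPolynomial.C (v k i))))
    unfold IsSemialgebraicMapOn
    convert! h using 1
    ext z
    simp only [mem_iUnion, mem_inter_iff, mem_iInter, mem_ofPred_eq, map_sub, map_add, map_mul,
      MvPolynomial.eval_X, MvPolynomial.eval_C, sub_eq_zero]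
    constructor
    · rintro ⟨⟨k, hk⟩, hz⟩
      exact ⟨k, hk, fun i => by rw [hz, hF k _ hk]; simp⟩
    · rintro ⟨k, hk, hz⟩
      exact ⟨⟨k, hk⟩, fun i => by rw [hz, hF k _ hk]; simp⟩

/-! ### The polygonal path and its pieces -/

/-- The affine parameter on `[a, b]` (or `[b, a]`), extended by constants. -/
noncomputable def clampedParam (a b x : ℝ) : ℝ := max 0 (min 1 ((x - a) / (b - a)))

lemma continuous_clampedParam (a b : ℝ) : Continuous (clampedParam a b) := by
  unfold clampedParam
  fun_prop

lemma clampedParam_mem (a b x : ℝ) : clampedParam a b x ∈ Icc (0 : ℝ) 1 :=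
  ⟨le_max_left _ _, max_le zero_le_one (min_le_left _ _)⟩

lemma clampedParam_lineMap {a b u : ℝ} (hab : a ≠ b) (hu : u ∈ Icc (0 : ℝ) 1) :
    clampedParam a b (AffineMap.lineMap a b u) = u := by
  have : b - a ≠ 0 := sub_ne_zero.2 hab.symm
  rw [clampedParam, AffineMap.lineMap_apply, vsub_eq_sub, vadd_eq_add, smul_eq_mul,
    add_sub_cancel_right, mul_div_cancel_right₀ _ this, min_eq_right hu.2, max_eq_right hu.1]

lemma clampedParam_right {a b : ℝ} (hab : a ≠ b) : clampedParam a b b = 1 := by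
  simpa using clampedParam_lineMap hab (u := 1) ⟨zero_le_one, le_rfl⟩

lemma clampedParam_of_mul_nonpos {a b x : ℝ} (h : (x - a) * (b - a) ≤ 0) :
    clampedParam a b x = 0 := by
  have : (x - a) / (b - a) ≤ 0 := by
    rw [div_eq_mul_inv]
    rcases mul_nonpos_iff.1 h with ⟨h1, h2⟩ | ⟨h1, h2⟩
    · exact mul_nonpos_of_nonneg_of_nonpos h1 (inv_nonpos.2 h2)
    · exact mul_nonpos_of_nonpos_of_nonneg h1 (inv_nonneg.2 h2)
  exact max_eq_left ((min_le_right _ _).trans this)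

section Polygonal

variable {n m : ℕ} {t : Fin (m + 1) → ℝ} {s : Fin m → ℝ}

lemma lt_of_interlaced (ht : StrictMono t)
    (hs : ∀ i : Fin m, s i ∈ Ioo (t i.castSucc) (t i.succ)) (j : Fin m) (k : Fin (m + 1)) :
    (j.castSucc < k → s j < t k) ∧ (k ≤ j.castSucc → t k < s j) :=
  ⟨fun h => (hs j).2.trans_le (ht.monotone (Fin.castSucc_lt_iff_succ_le.1 h)),
    fun h => (ht.monotone h).trans_lt (hs j).1⟩

lemma strictMono_of_interlaced (ht : StrictMono t)
    (hs : ∀ i : Fin m, s i ∈ Ioo (t i.castSucc) (t i.succ)) : StrictMono s := fun i j hij =>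
  ((lt_of_interlaced ht hs i j.castSucc).1 (Fin.castSucc_lt_castSucc_iff.2 hij)).trans (hs j).1

/-- The index `k` of the interval `(s (k - 1), s k]` that contains `x`. -/
lemma exists_pieceIndex (hsm : StrictMono s) (x : ℝ) :
    ∃ k : Fin (m + 1), ∀ j : Fin m, s j < x ↔ j.castSucc < k := by
  classical
  by_cases h : ∃ j, s j < x
  · have hne : (Finset.univ.filter fun j => s j < x).Nonempty := by
      obtain ⟨j, hj⟩ := h
      exact ⟨j, by simpa using hj⟩
    set M := (Finset.univ.filter fun j => s j < x).max' hne
    have hM : s M < x := by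
      have := Finset.max'_mem _ hne
      simpa using this
    refine ⟨M.succ, fun j => ?_⟩
    rw [Fin.castSucc_lt_succ_iff]
    exact ⟨fun hj => Finset.le_max' _ _ (by simpa using hj),
      fun hj => (hsm.monotone hj).trans_lt hM⟩
  · push Not at h
    exact ⟨0, fun j => ⟨fun hj => absurd hj (not_lt.2 (h j)), fun hj => absurd hj (by simp)⟩⟩

/-- The index `k` of the interval `(s (k - 1), s k]` that contains `x`. -/
noncomputable def pieceIndex (hsm : StrictMono s) (x : ℝ) : Fin (m + 1) :=
  (exists_pieceIndex hsm x).choose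

lemma lt_iff_castSucc_lt_pieceIndex (hsm : StrictMono s) (x : ℝ) (j : Fin m) :
    s j < x ↔ j.castSucc < pieceIndex hsm x :=
  (exists_pieceIndex hsm x).choose_spec j

lemma pieceIndex_eq (hsm : StrictMono s) {x : ℝ} {k : Fin (m + 1)}
    (h : ∀ j : Fin m, s j < x ↔ j.castSucc < k) : pieceIndex hsm x = k := by
  have h' := fun j => (lt_iff_castSucc_lt_pieceIndex hsm x j).symm.trans (h j)
  by_contra hne
  rcases lt_or_gt_of_ne hne with hlt | hlt
  · obtain ⟨j, hj⟩ := Fin.exists_castSucc_eq.2 (hlt.trans_le (Fin.le_last _)).ne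
    have := (h' j).2 (by rwa [hj])
    rw [hj] at this
    exact lt_irrefl _ this
  · obtain ⟨j, hj⟩ := Fin.exists_castSucc_eq.2 (hlt.trans_le (Fin.le_last _)).ne
    have := (h' j).1 (by rwa [hj])
    rw [hj] at this
    exact lt_irrefl _ this

lemma eventually_pieceIndex_eq (hsm : StrictMono s) {x : ℝ} (hx : ∀ j, x ≠ s j) :
    ∀ᶠ y in 𝓝 x, pieceIndex hsm y = pieceIndex hsm x := by
  have : ∀ j, ∀ᶠ y in 𝓝 x, s j < y ↔ s j < x := fun j => by
    rcases lt_or_gt_of_ne (hx j) with h | h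
    · filter_upwards [gt_mem_nhds h] with y hy
      exact iff_of_false (not_lt.2 (le_of_lt hy)) (not_lt.2 h.le)
    · filter_upwards [lt_mem_nhds h] with y hy
      exact iff_of_true hy h
  filter_upwards [Filter.eventually_all.2 this] with y hy
  exact pieceIndex_eq hsm fun j => (hy j).trans (lt_iff_castSucc_lt_pieceIndex hsm x j)

/-- The half-open convention assigns `s i` itself to the left piece; the value at that node does not
affect containment off the nodes. -/
lemma eventually_pieceIndex_eq_ite (hsm : StrictMono s) (i : Fin m) :
    ∀ᶠ y in 𝓝 (s i), pieceIndex hsm y = if y ≤ s i then i.castSucc else i.succ := by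
  have : ∀ j, ∀ᶠ y in 𝓝 (s i), j ≠ i → (s j < y ↔ j < i) := fun j => by
    rcases lt_trichotomy j i with h | h | h
    · filter_upwards [lt_mem_nhds (hsm h)] with y hy _
      exact iff_of_true hy h
    · exact Filter.Eventually.of_forall fun y hy => absurd h hy
    · filter_upwards [gt_mem_nhds (hsm h)] with y hy _
      exact iff_of_false (not_lt.2 (le_of_lt hy)) (not_lt.2 h.le)
  filter_upwards [Filter.eventually_all.2 this] with y hy
  refine pieceIndex_eq hsm fun j => ?_
  split_ifs with hyi
  · rw [Fin.castSucc_lt_castSucc_iff]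
    by_cases hj : j = i
    · subst hj
      exact iff_of_false (not_lt.2 hyi) (lt_irrefl _)
    · exact hy j hj
  · rw [Fin.castSucc_lt_succ_iff]
    by_cases hj : j = i
    · subst hj
      exact iff_of_true (not_le.1 hyi) le_rfl
    · rw [hy j hj]
      exact ⟨le_of_lt, fun h => lt_of_le_of_ne h hj⟩

lemma pieceIndex_castSucc (ht : StrictMono t)
    (hs : ∀ i : Fin m, s i ∈ Ioo (t i.castSucc) (t i.succ)) (hsm : StrictMono s) {i : Fin m} {x : ℝ}
    (hx : x ∈ Icc (t i.castSucc) (s i)) : pieceIndex hsm x = i.castSucc :=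
  pieceIndex_eq hsm fun j => ⟨fun h => by
      rw [Fin.castSucc_lt_castSucc_iff]
      exact hsm.lt_iff_lt.1 (h.trans_le hx.2),
    fun h => ((lt_of_interlaced ht hs j _).1 h).trans_le hx.1⟩

lemma pieceIndex_succ (ht : StrictMono t)
    (hs : ∀ i : Fin m, s i ∈ Ioo (t i.castSucc) (t i.succ)) (hsm : StrictMono s) {i : Fin m} {x : ℝ}
    (hx : x ∈ Ioc (s i) (t i.succ)) : pieceIndex hsm x = i.succ :=
  pieceIndex_eq hsm fun j => ⟨fun h => by
      by_contra hc
      exact (h.trans_le hx.2).not_gt ((lt_of_interlaced ht hs j _).2 (not_lt.1 hc)),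
    fun h => (hsm.monotone (Fin.castSucc_lt_succ_iff.1 h)).trans_lt hx.1⟩

lemma pieceIndex_apply (ht : StrictMono t)
    (hs : ∀ i : Fin m, s i ∈ Ioo (t i.castSucc) (t i.succ)) (hsm : StrictMono s) (k : Fin (m + 1)) :
    pieceIndex hsm (t k) = k :=
  pieceIndex_eq hsm fun j => ⟨fun h => by
      by_contra hc
      exact h.not_gt ((lt_of_interlaced ht hs j _).2 (not_lt.1 hc)),
    (lt_of_interlaced ht hs j k).1⟩

variable (t s) in
/-- The displacement from `p k` on the side of `q (k - 1)`. -/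
noncomputable def leftLeg (p : Fin (m + 1) → EuclideanSpace ℝ (Fin n))
    (q : Fin m → EuclideanSpace ℝ (Fin n)) (x : ℝ) (k : Fin (m + 1)) : EuclideanSpace ℝ (Fin n) :=
  Fin.cases (motive := fun _ => EuclideanSpace ℝ (Fin n)) 0
    (fun j => clampedParam (t j.succ) (s j) x • (q j - p j.succ)) k

variable (t s) in
/-- The displacement from `p k` on the side of `q k`. -/
noncomputable def rightLeg (p : Fin (m + 1) → EuclideanSpace ℝ (Fin n))
    (q : Fin m → EuclideanSpace ℝ (Fin n)) (x : ℝ) (k : Fin (m + 1)) : EuclideanSpace ℝ (Fin n) :=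
  Fin.lastCases (motive := fun _ => EuclideanSpace ℝ (Fin n)) 0
    (fun j => clampedParam (t j.castSucc) (s j) x • (q j - p j.castSucc)) k

variable (t) in
/-- The polygonal path with vertices `p 0, q 0, p 1, …` at the times `t 0, s 0, t 1, …`, constant
before the first and after the last of these times. -/
noncomputable def polygonalPath (hsm : StrictMono s) (p : Fin (m + 1) → EuclideanSpace ℝ (Fin n))
    (q : Fin m → EuclideanSpace ℝ (Fin n)) (x : ℝ) : EuclideanSpace ℝ (Fin n) :=
  p (pieceIndex hsm x) + leftLeg t s p q x (pieceIndex hsm x)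
    + rightLeg t s p q x (pieceIndex hsm x)

variable {p : Fin (m + 1) → EuclideanSpace ℝ (Fin n)} {q : Fin m → EuclideanSpace ℝ (Fin n)}

lemma continuous_leftLeg (k : Fin (m + 1)) : Continuous fun x => leftLeg t s p q x k := by
  cases k using Fin.cases with
  | zero => exact continuous_const
  | succ j => exact (continuous_clampedParam _ _).smul continuous_const

lemma continuous_rightLeg (k : Fin (m + 1)) : Continuous fun x => rightLeg t s p q x k := by
  cases k using Fin.lastCases with
  | last => simpa [rightLeg] using continuous_const
  | cast j =>
    simp only [rightLeg, Fin.lastCases_castSucc]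
    exact (continuous_clampedParam _ _).smul continuous_const

variable (hs : ∀ i : Fin m, s i ∈ Ioo (t i.castSucc) (t i.succ))

include hs

/-- The clamped parameter runs backwards from `t k` to the preceding `s`. With `rightLeg_eq_zero`,
at most one leg is nonzero at any time, so one formula describes the whole bend at `p k`. -/
lemma leftLeg_eq_zero {x : ℝ} {k : Fin (m + 1)} (hx : t k ≤ x) : leftLeg t s p q x k = 0 := by
  cases k using Fin.cases with
  | zero => rfl
  | succ j =>
    change clampedParam (t j.succ) (s j) x • _ = (0 : EuclideanSpace ℝ (Fin n))
    rw [clampedParam_of_mul_nonpos, zero_smul]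
    exact mul_nonpos_of_nonneg_of_nonpos (sub_nonneg.2 hx) (sub_nonpos.2 (hs j).2.le)

lemma rightLeg_eq_zero {x : ℝ} {k : Fin (m + 1)} (hx : x ≤ t k) : rightLeg t s p q x k = 0 := by
  cases k using Fin.lastCases with
  | last => simp [rightLeg]
  | cast j =>
    simp only [rightLeg, Fin.lastCases_castSucc]
    rw [clampedParam_of_mul_nonpos, zero_smul]
    exact mul_nonpos_of_nonpos_of_nonneg (sub_nonpos.2 hx) (sub_nonneg.2 (hs j).1.le)

lemma polygonalPath_of_mem_left (ht : StrictMono t) (hsm : StrictMono s) {i : Fin m} {x : ℝ}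
    (hx : x ∈ Icc (t i.castSucc) (s i)) : polygonalPath t hsm p q x
      = p i.castSucc + clampedParam (t i.castSucc) (s i) x • (q i - p i.castSucc) := by
  rw [polygonalPath, pieceIndex_castSucc ht hs hsm hx, leftLeg_eq_zero hs hx.1, add_zero]
  simp [rightLeg]

lemma polygonalPath_of_mem_right (ht : StrictMono t) (hsm : StrictMono s) {i : Fin m} {x : ℝ}
    (hx : x ∈ Ioc (s i) (t i.succ)) : polygonalPath t hsm p q x
      = p i.succ + clampedParam (t i.succ) (s i) x • (q i - p i.succ) := by
  rw [polygonalPath, pieceIndex_succ ht hs hsm hx, rightLeg_eq_zero hs hx.2, add_zero]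
  rfl

lemma polygonalPath_apply_t (ht : StrictMono t) (hsm : StrictMono s) (k : Fin (m + 1)) :
    polygonalPath t hsm p q (t k) = p k := by
  rw [polygonalPath, pieceIndex_apply ht hs hsm, leftLeg_eq_zero hs le_rfl,
    rightLeg_eq_zero hs le_rfl, add_zero, add_zero]

lemma polygonalPath_apply_s (ht : StrictMono t) (hsm : StrictMono s) (i : Fin m) :
    polygonalPath t hsm p q (s i) = q i := by
  rw [polygonalPath_of_mem_left hs ht hsm ⟨(hs i).1.le, le_rfl⟩, clampedParam_right (hs i).1.ne]
  simp

lemma isPolygonalParam_polygonalPath (ht : StrictMono t) (hsm : StrictMono s) :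
    IsPolygonalParam t s p q (polygonalPath t hsm p q) where
  at_t := polygonalPath_apply_t hs ht hsm
  at_s := polygonalPath_apply_s hs ht hsm
  affine_left i u hu := by
    have hx : AffineMap.lineMap (t i.castSucc) (s i) u ∈ Icc (t i.castSucc) (s i) := by
      rw [AffineMap.lineMap_apply, vsub_eq_sub, vadd_eq_add, smul_eq_mul]
      constructor <;> nlinarith [(hs i).1, hu.1, hu.2]
    rw [polygonalPath_of_mem_left hs ht hsm hx, clampedParam_lineMap (hs i).1.ne hu,
      AffineMap.lineMap_apply, vsub_eq_sub, vadd_eq_add, add_comm]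
  affine_right i u hu := by
    rcases hu.1.eq_or_lt with h0 | h0
    · rw [← h0, AffineMap.lineMap_apply_zero, AffineMap.lineMap_apply_zero,
        polygonalPath_apply_s hs ht hsm]
    · have hx : AffineMap.lineMap (s i) (t i.succ) u ∈ Ioc (s i) (t i.succ) := by
        rw [AffineMap.lineMap_apply, vsub_eq_sub, vadd_eq_add, smul_eq_mul]
        constructor <;> nlinarith [(hs i).2, hu.1, hu.2]
      rw [polygonalPath_of_mem_right hs ht hsm hx, ← AffineMap.lineMap_apply_one_sub,
        clampedParam_lineMap (hs i).2.ne' ⟨by linarith [hu.2], by linarith [hu.1]⟩,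
        AffineMap.lineMap_apply, vsub_eq_sub, vadd_eq_add]
      module

lemma continuous_polygonalPath (hsm : StrictMono s) :
    Continuous (polygonalPath t hsm p q) := by
  let P : Fin (m + 1) → ℝ → EuclideanSpace ℝ (Fin n) := fun k x =>
    p k + leftLeg t s p q x k + rightLeg t s p q x k
  have hP : ∀ k, Continuous (P k) := fun k =>
    (continuous_const.add (continuous_leftLeg k)).add (continuous_rightLeg k)
  refine continuous_iff_continuousAt.2 fun x => ?_
  by_cases hx : ∃ i, x = s i
  · obtain ⟨i, rfl⟩ := hx
    have hval : P i.castSucc (s i) = P i.succ (s i) := by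
      simp only [P]
      rw [leftLeg_eq_zero hs (hs i).1.le, rightLeg_eq_zero hs (hs i).2.le]
      simp [leftLeg, rightLeg, clampedParam_right (hs i).1.ne, clampedParam_right (hs i).2.ne']
    have hc : Continuous fun y => if y ≤ s i then P i.castSucc y else P i.succ y :=
      (hP _).if_le (hP _) continuous_id continuous_const fun y hy => by
        rw [show y = s i from hy, hval]
    refine hc.continuousAt.congr ?_
    filter_upwards [eventually_pieceIndex_eq_ite hsm i] with y hy
    simp only [polygonalPath, hy]
    split_ifs <;> rfl
  · have hx' : ∀ i, x ≠ s i := by simpa using hx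
    refine (hP (pieceIndex hsm x)).continuousAt.congr ?_
    filter_upwards [eventually_pieceIndex_eq hsm hx'] with y hy
    simp only [polygonalPath, hy]
    rfl

lemma polygonalPath_mem_closure (hsm : StrictMono s)
    {S : Fin (m + 1) → Set (EuclideanSpace ℝ (Fin n))} (hSc : ∀ k, Convex ℝ (S k))
    (hp : ∀ k, p k ∈ closure (S k))
    (hq : ∀ i : Fin m, q i ∈ closure (S i.castSucc) ∧ q i ∈ closure (S i.succ)) (x : ℝ) :
    polygonalPath t hsm p q x ∈ closure (S (pieceIndex hsm x)) := by
  rw [polygonalPath]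
  -- Whatever the index, only one leg is active. The point then lies on a segment from `p k` to an
  -- adjacent base point, or equals `p k`, and the closure of `S k` is convex.
  generalize pieceIndex hsm x = k
  rcases le_total x (t k) with h | h
  · rw [rightLeg_eq_zero hs h, add_zero]
    cases k using Fin.cases with
    | zero => simpa [leftLeg] using hp 0
    | succ j =>
      exact (hSc _).closure.add_smul_sub_mem (hp _) (hq j).2 (clampedParam_mem _ _ _)
  · rw [leftLeg_eq_zero hs h, add_zero]
    cases k using Fin.lastCases with
    | last => simpa [rightLeg] using hp _
    | cast j =>
      simp only [rightLeg, Fin.lastCases_castSucc]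
      exact (hSc _).closure.add_smul_sub_mem (hp _) (hq j).1 (clampedParam_mem _ _ _)

end Polygonal

/-! ### The singular set of a polygonal path -/

lemma eq_add_smul_of_lineMap {E : Type*} [AddCommGroup E] [Module ℝ E] {f : ℝ → E} {a b : ℝ}
    (hab : a < b) {p q : E}
    (h : ∀ u ∈ Icc (0 : ℝ) 1, f (AffineMap.lineMap a b u) = AffineMap.lineMap p q u) {x : ℝ}
    (hx : x ∈ Icc a b) :
    f x = (p - a • (b - a)⁻¹ • (q - p)) + x • (b - a)⁻¹ • (q - p) := by
  have hba : 0 < b - a := sub_pos.2 hab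
  have hu : (x - a) / (b - a) ∈ Icc (0 : ℝ) 1 :=
    ⟨div_nonneg (sub_nonneg.2 hx.1) hba.le, (div_le_one hba).2 (by linarith [hx.2])⟩
  have h1 := h _ hu
  rw [AffineMap.lineMap_apply, vsub_eq_sub, vadd_eq_add, smul_eq_mul, div_mul_cancel₀ _ hba.ne',
    sub_add_cancel, AffineMap.lineMap_apply, vsub_eq_sub, vadd_eq_add, div_eq_mul_inv] at h1
  rw [h1]
  module

/-- A polygonal path is Nash off its inner vertices. -/
lemma IsPolygonalParam.isNashOn {n m : ℕ} {t : Fin (m + 1) → ℝ} {s : Fin m → ℝ}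
    {p : Fin (m + 1) → EuclideanSpace ℝ (Fin n)} {q : Fin m → EuclideanSpace ℝ (Fin n)}
    {β : ℝ → EuclideanSpace ℝ (Fin n)} (hβ : IsPolygonalParam t s p q β) (ht : StrictMono t)
    (hs : ∀ i : Fin m, s i ∈ Ioo (t i.castSucc) (t i.succ)) :
    IsNashOn β (Icc (t 0) (t (Fin.last m)) \
      (t '' {i | i ≠ 0 ∧ i ≠ Fin.last m} ∪ range s)) := by
  have hsm := strictMono_of_interlaced ht hs
  cases m with
  | zero =>
    -- With a single control point the time interval is a point, where a constant extension
    -- suffices.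
    refine isNashOn_of_affine_on_Ioo (κ := Unit) (fun _ => t 0 - 1) (fun _ => t 0 + 1)
      (fun _ => p 0) (fun _ => 0) (fun _ => p 0) β (fun _ _ _ => by simp) ?_ ?_
    · rintro x ⟨⟨h1, h2⟩, -⟩
      rw [show Fin.last 0 = 0 from rfl] at h2
      exact mem_iUnion.2 ⟨(), by linarith, by linarith⟩
    · rintro x ⟨⟨h1, h2⟩, -⟩
      rw [show x = t 0 from le_antisymm h2 h1, hβ.at_t]
  | succ m =>
    -- The Boolean selects the half before (`false`) or after (`true`) `s i`. The two extreme
    -- intervals are lengthened by one because the endpoint times are not removed and need an open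
    -- neighbourhood.
    let lo : Fin (m + 1) × Bool → ℝ := fun k =>
      if k.2 then s k.1 else if k.1 = 0 then t 0 - 1 else t k.1.castSucc
    let hi : Fin (m + 1) × Bool → ℝ := fun k =>
      if k.2 then (if k.1 = Fin.last m then t (Fin.last (m + 1)) + 1 else t k.1.succ) else s k.1
    let v : Fin (m + 1) × Bool → EuclideanSpace ℝ (Fin n) := fun k =>
      if k.2 then (t k.1.succ - s k.1)⁻¹ • (p k.1.succ - q k.1)
      else (s k.1 - t k.1.castSucc)⁻¹ • (q k.1 - p k.1.castSucc)
    let u : Fin (m + 1) × Bool → EuclideanSpace ℝ (Fin n) := fun k =>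
      if k.2 then q k.1 - s k.1 • v k else p k.1.castSucc - t k.1.castSucc • v k
    -- The first and last affine pieces are continued past the ends, since nothing is known about
    -- `β` there.
    let F : ℝ → EuclideanSpace ℝ (Fin n) := fun x =>
      if x < t 0 then u (0, false) + x • v (0, false)
      else if t (Fin.last (m + 1)) < x then u (Fin.last m, true) + x • v (Fin.last m, true)
      else β x
    have hleft : ∀ i, ∀ x ∈ Icc (t i.castSucc) (s i), β x = u (i, false) + x • v (i, false) :=
      fun i x hx => eq_add_smul_of_lineMap (hs i).1 (hβ.affine_left i) hx
    have hright : ∀ i, ∀ x ∈ Icc (s i) (t i.succ), β x = u (i, true) + x • v (i, true) :=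
      fun i x hx => eq_add_smul_of_lineMap (hs i).2 (hβ.affine_right i) hx
    have hFmid : ∀ x ∈ Icc (t 0) (t (Fin.last (m + 1))), F x = β x := fun x hx => by
      simp only [F, if_neg (not_lt.2 hx.1), if_neg (not_lt.2 hx.2)]
    refine isNashOn_of_affine_on_Ioo lo hi u v F β ?_ ?_ fun x hx => hFmid x hx.1
    · rintro ⟨i, b⟩ x ⟨h1, h2⟩
      cases b with
      | false =>
        simp only [lo, hi, Bool.false_eq_true, if_false] at h1 h2
        have hlast : x ≤ t (Fin.last (m + 1)) :=
          h2.le.trans ((hs i).2.le.trans (ht.monotone (Fin.le_last _)))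
        by_cases hx0 : x < t 0
        · by_cases hi0 : i = 0
          · subst hi0
            simp only [F, if_pos hx0]
          · rw [if_neg hi0] at h1
            exact absurd ((ht.monotone (Fin.zero_le _)).trans_lt h1) hx0.not_gt
        · rw [hFmid x ⟨not_lt.1 hx0, hlast⟩]
          refine hleft i x ⟨?_, h2.le⟩
          by_cases hi0 : i = 0
          · subst hi0
            exact not_lt.1 hx0
          · rw [if_neg hi0] at h1
            exact h1.le
      | true =>
        simp only [lo, hi, if_true] at h1 h2
        have h0 : t 0 ≤ x := (ht.monotone (Fin.zero_le _)).trans ((hs i).1.le.trans h1.le)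
        by_cases hx1 : t (Fin.last (m + 1)) < x
        · by_cases hil : i = Fin.last m
          · subst hil
            simp only [F, if_neg (not_lt.2 h0), if_pos hx1]
          · rw [if_neg hil] at h2
            exact absurd (h2.trans_le (ht.monotone (Fin.le_last _))) hx1.not_gt
        · rw [hFmid x ⟨h0, not_lt.1 hx1⟩]
          refine hright i x ⟨h1.le, ?_⟩
          by_cases hil : i = Fin.last m
          · subst hil
            exact not_lt.1 hx1
          · rw [if_neg hil] at h2
            exact h2.le
    · rintro x ⟨⟨h0, h1⟩, hx⟩
      have hxs : ∀ j, x ≠ s j := fun j h => hx (Or.inr ⟨j, h.symm⟩)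
      have hlo : ∀ i : Fin (m + 1), lo (i, false) ≤ t i.castSucc := fun i => by
        simp only [lo, Bool.false_eq_true, if_false]
        split_ifs with h
        · subst h
          exact (sub_one_lt _).le
        · exact le_rfl
      have hhi : ∀ i : Fin (m + 1), t i.succ ≤ hi (i, true) := fun i => by
        simp only [hi, if_true]
        split_ifs with h
        · subst h
          exact (lt_add_one _).le
        · exact le_rfl
      obtain ⟨k, hk⟩ : ∃ k, pieceIndex hsm x = k := ⟨_, rfl⟩
      have hkj : ∀ j : Fin (m + 1), s j < x ↔ j.castSucc < k := fun j => by
        rw [← hk]; exact lt_iff_castSucc_lt_pieceIndex hsm x j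
      rcases lt_trichotomy x (t k) with h | h | h
      · cases k using Fin.cases with
        | zero => exact absurd h (not_lt.2 h0)
        | succ j =>
          refine mem_iUnion.2 ⟨(j, true), ?_, h.trans_le (hhi j)⟩
          exact (hkj j).2 (Fin.castSucc_lt_succ_iff.2 le_rfl)
      · by_cases hk0 : k = 0
        · subst hk0
          refine mem_iUnion.2 ⟨(0, false), ?_, ?_⟩
          · change t 0 - 1 < x
            linarith
          · change x < s 0
            rw [h]
            exact (hs 0).1
        · by_cases hkl : k = Fin.last (m + 1)
          · subst hkl
            refine mem_iUnion.2 ⟨(Fin.last m, true), ?_, ?_⟩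
            · change s (Fin.last m) < x
              rw [h]
              exact (hs (Fin.last m)).2
            · simp only [hi, if_true]
              linarith
          · exact absurd (Or.inl ⟨k, ⟨hk0, hkl⟩, h.symm⟩) hx
      · cases k using Fin.lastCases with
        | last => exact absurd h (not_lt.2 h1)
        | cast j =>
          refine mem_iUnion.2 ⟨(j, false), (hlo j).trans_lt h, ?_⟩
          refine lt_of_le_of_ne (not_lt.1 fun hc => ?_) (hxs j)
          exact lt_irrefl _ ((hkj j).1 hc)

lemma IsPolygonalParam.nashSingularSet_subset {n m : ℕ} {t : Fin (m + 1) → ℝ} {s : Fin m → ℝ}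
    {p : Fin (m + 1) → EuclideanSpace ℝ (Fin n)} {q : Fin m → EuclideanSpace ℝ (Fin n)}
    {β : ℝ → EuclideanSpace ℝ (Fin n)} (hβ : IsPolygonalParam t s p q β) (ht : StrictMono t)
    (hs : ∀ i : Fin m, s i ∈ Ioo (t i.castSucc) (t i.succ)) :
    nashSingularSet β (t 0) (t (Fin.last m)) ⊆
      t '' {i | i ≠ 0 ∧ i ≠ Fin.last m} ∪ range s := by
  refine sInter_subset_of_mem ⟨((toFinite _).image t).union (finite_range s), ?_,
    hβ.isNashOn ht hs⟩
  rintro x (⟨i, -, rfl⟩ | ⟨i, rfl⟩)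
  · exact ⟨ht.monotone (Fin.zero_le _), ht.monotone (Fin.le_last _)⟩
  · exact ⟨(ht.monotone (Fin.zero_le _)).trans (hs i).1.le,
      (hs i).2.le.trans (ht.monotone (Fin.le_last _))⟩

/-! ### Assembly of the theorem -/

lemma eventually_ball_pow_mono {E : Type*} [PseudoMetricSpace E] {S : ℝ → Set E} {f : ℝ → E} {a : ℝ}
    {N M : ℕ} (hNM : N ≤ M) {l : Filter ℝ} (hl : l ≤ 𝓝 a)
    (h : ∀ᶠ x in l, Metric.ball (f x) (|x - a| ^ N) ⊆ S x) :
    ∀ᶠ x in l, Metric.ball (f x) (|x - a| ^ M) ⊆ S x := by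
  filter_upwards [h, hl (eventually_abs_sub_pow_le hNM a)] with x h1 h2
  exact (Metric.ball_subset_ball h2).trans h1

theorem mainTheorem2 (n m : ℕ)
    (S : Fin (m + 1) → Set (EuclideanSpace ℝ (Fin n)))
    (hS : ∀ i, IsPolyhedronInterior (S i))
    (p : Fin (m + 1) → EuclideanSpace ℝ (Fin n))
    (hp : ∀ i, p i ∈ closure (S i))
    (Γ : Fin m → Set (EuclideanSpace ℝ (Fin n)))
    (q : Fin m → EuclideanSpace ℝ (Fin n))
    (hq : ∀ i : Fin m, IsNashBridge (S i.castSucc) (S i.succ) (Γ i) (q i))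
    (t : Fin (m + 1) → ℝ) (ht : StrictMono t) (ht0 : 0 < t 0) (ht1 : t (Fin.last m) < 1)
    (s : Fin m → ℝ) (hs : ∀ i : Fin m, s i ∈ Ioo (t i.castSucc) (t i.succ)) :
    ∃ β : ℝ → EuclideanSpace ℝ (Fin n),
      IsPolygonalParam t s p q β ∧
      MapsTo β (Icc (t 0) (t (Fin.last m))) (closure (⋃ i, S i)) ∧
      nashSingularSet β (t 0) (t (Fin.last m)) ⊆
        (t '' {i | i ≠ 0 ∧ i ≠ Fin.last m}) ∪ range s ∧
      ∀ ε : ℝ, 0 < ε → ∃ A : Fin n → ℝ[X],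
        polyPath A '' Icc 0 1 ⊆ (⋃ i, S i) ∪ (range p ∪ range q) ∧
        (∀ i, polyPath A (t i) = p i) ∧
        (∀ i : Fin m,
          polyPath A '' Ioo (t i.castSucc) (s i) ⊆ S i.castSucc ∧
          polyPath A '' Ioo (s i) (t i.succ) ⊆ S i.succ ∧
          polyPath A (s i) = q i) ∧
        (∀ x ∈ Icc (t 0) (t (Fin.last m)), ‖polyPath A x - β x‖ < ε) := by
  have hsm := strictMono_of_interlaced ht hs
  have hSo : ∀ k, IsOpen (S k) := fun k => (hS k).isOpen
  have hSc : ∀ k, Convex ℝ (S k) := fun k => (hS k).convex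
  have hqc := fun i => (hq i).mem_closure
  set β := polygonalPath t hsm p q
  have hβ : IsPolygonalParam t s p q β := isPolygonalParam_polygonalPath hs ht hsm
  have hβS : ∀ x, β x ∈ closure (S (pieceIndex hsm x)) :=
    polygonalPath_mem_closure hs hsm hSc hp hqc
  refine ⟨β, hβ, fun x _ => closure_mono (subset_iUnion S _) (hβS x),
    hβ.nashSingularSet_subset ht hs, fun ε hε => ?_⟩
  have ht01 : ∀ k, t k ∈ Ioo (0 : ℝ) 1 := fun k =>
    ⟨ht0.trans_le (ht.monotone (Fin.zero_le _)), (ht.monotone (Fin.le_last _)).trans_lt ht1⟩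
  have hs01 : ∀ i, s i ∈ Ioo (0 : ℝ) 1 := fun i =>
    ⟨(ht01 _).1.trans (hs i).1, (hs i).2.trans (ht01 _).2⟩
  have hts : ∀ k i, t k ≠ s i := fun k i h => by
    rcases lt_or_ge i.castSucc k with hc | hc
    · exact ((lt_of_interlaced ht hs i k).1 hc).ne h.symm
    · exact ((lt_of_interlaced ht hs i k).2 hc).ne h
  choose gt hgt hgtS using fun k => exists_polyPath_touching (hSo k) (hSc k) (hp k) (t k)
  choose gs N hgs hgsl hgsr using fun i => (hq i).exists_polyPath (hS _) (hS _) (s i)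
  -- A common exponent: at least 3 for the control points and at least every `N i` for the bridges.
  let M := 3 + Finset.univ.sup N
  have hNM : ∀ i, N i ≤ M := fun i =>
    (Finset.le_sup (Finset.mem_univ i)).trans (Nat.le_add_left _ _)
  have hτ : Function.Injective (Sum.elim t s) := ht.injective.sumElim hsm.injective hts
  have hleft : ∀ i : Fin m, ∀ x ∈ Ioo (t i.castSucc) (s i), ∀ j, x ≠ Sum.elim t s j := by
    rintro i x hx (k | j) rfl
    · have h1 := ht.lt_iff_lt.1 hx.1
      exact hx.2.not_gt ((lt_of_interlaced ht hs i k).1 h1)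
    · have h1 := hsm.lt_iff_lt.1 hx.2
      exact hx.1.not_gt ((lt_of_interlaced ht hs j _).1 (Fin.castSucc_lt_castSucc_iff.2 h1))
  have hright : ∀ i : Fin m, ∀ x ∈ Ioo (s i) (t i.succ), ∀ j, x ≠ Sum.elim t s j := by
    rintro i x hx (k | j) rfl
    · have h1 := Fin.le_castSucc_iff.2 (ht.lt_iff_lt.1 hx.2)
      exact hx.1.not_gt ((lt_of_interlaced ht hs i k).2 h1)
    · have h1 := hsm.lt_iff_lt.1 hx.1
      exact hx.2.not_gt ((lt_of_interlaced ht hs j _).2 (Fin.castSucc_lt_iff_succ_le.1 h1))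
  have hloc : ∀ j, ∀ᶠ x in 𝓝[≠] Sum.elim t s j,
      Metric.ball (polyPath (Sum.elim gt gs j) x) (|x - Sum.elim t s j| ^ M)
        ⊆ S (pieceIndex hsm x) := by
    rintro (k | i)
    · refine eventually_ball_pow_mono (N := 3) (Nat.le_add_right _ _) nhdsWithin_le_nhds ?_
      filter_upwards [hgtS k, nhdsWithin_le_nhds (eventually_pieceIndex_eq hsm (hts k))] with x h1 h2
      rw [h2, show pieceIndex hsm (Sum.elim t s (Sum.inl k)) = k from pieceIndex_apply ht hs hsm k]
      exact h1
    · have hidx := eventually_pieceIndex_eq_ite hsm i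
      refine eventually_ball_pow_mono (hNM i) nhdsWithin_le_nhds ?_
      change ∀ᶠ x in 𝓝[≠] (s i), _
      rw [← nhdsLT_sup_nhdsGT, Filter.eventually_sup]
      constructor
      · filter_upwards [hgsl i, nhdsWithin_le_nhds hidx, self_mem_nhdsWithin] with x h1 h2 h3
        rw [h2, if_pos (le_of_lt h3)]
        exact h1
      · filter_upwards [hgsr i, nhdsWithin_le_nhds hidx, self_mem_nhdsWithin] with x h1 h2 h3
        rw [h2, if_neg (not_le.2 h3)]
        exact h1
  obtain ⟨A, hA1, hA2, hA3⟩ := exists_polyPath_of_local hτ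
    (by rintro (k | i); exacts [Ioo_subset_Icc_self (ht01 k), Ioo_subset_Icc_self (hs01 i)])
    hSo hSc (fun x hx => eventually_pieceIndex_eq hsm fun j => hx (Sum.inr j))
    (continuous_polygonalPath hs hsm) hβS (Sum.elim gt gs)
    (by rintro (k | i); exacts [(hgt k).trans (hβ.at_t k).symm, (hgs i).trans (hβ.at_s i).symm])
    (N := M) (by simp [M]) hloc hε
  refine ⟨A, ?_, fun k => (hA2 (Sum.inl k)).trans (hβ.at_t k), fun i => ⟨?_, ?_,
    (hA2 (Sum.inr i)).trans (hβ.at_s i)⟩, fun x hx =>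
    hA3 x ⟨ht0.le.trans hx.1, hx.2.trans ht1.le⟩⟩
  · rintro _ ⟨x, hx, rfl⟩
    by_cases hn : ∃ j, x = Sum.elim t s j
    · obtain ⟨k | i, rfl⟩ := hn
      · exact Or.inr (Or.inl ⟨k, ((hA2 (Sum.inl k)).trans (hβ.at_t k)).symm⟩)
      · exact Or.inr (Or.inr ⟨i, ((hA2 (Sum.inr i)).trans (hβ.at_s i)).symm⟩)
    · exact Or.inl (mem_iUnion.2 ⟨_, hA1 x hx (not_exists.1 hn)⟩)
  · rintro _ ⟨x, hx, rfl⟩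
    have := hA1 x ⟨(ht01 _).1.le.trans hx.1.le, hx.2.le.trans (hs01 _).2.le⟩ (hleft i x hx)
    rwa [pieceIndex_castSucc ht hs hsm (Ioo_subset_Icc_self hx)] at this
  · rintro _ ⟨x, hx, rfl⟩
    have := hA1 x ⟨(hs01 _).1.le.trans hx.1.le, hx.2.le.trans (ht01 _).2.le⟩ (hright i x hx)
    rwa [pieceIndex_succ ht hs hsm (Ioo_subset_Ioc_self hx)] at this
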